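/- Let $n\ge 0$ and let $\mathcal A=\{H_1,\dots,H_m\}$ be a finite multiarrangement of linear hyperplanes in $\mathbb R^n$ (repeats allowed, $m\ge 0$), with nonzero normal vectors $a_1,\dots,a_m\in\mathbb R^n$, and let $2\mathcal A$ be the multiarrangement of size $2m$ in which every $H_i$ is taken twice. Use the same symbols for the complexifications in $\mathbb C^n$. For a multiarrangement $\mathcal B$ of linear hyperplanes in $\mathbb C^n$ and a line $L=\mathbb C\cdot(\ell_1,\dots,\ell_n)\subseteq\mathbb C^n$, let $\lambda_L=\ell_1x_1+\cdots+\ell_nx_n$, let $\rho_{\mathcal B}(L)$ be the number of hyperplanes of $\mathcal B$, counted with multiplicity, that do not contain $L$, and let $$J_{\mathcal B,1}=\bigl(\lambda_L^{\rho_{\mathcal B}(L)+1} : L\subseteq\mathbb C^n\text{ a line}\bigr)\subseteq\mathbb C[x_1,\dots,x_n].$$ Let $\Omega_n=\mathbb C[x_1,\dots,x_n]\otimes\wedge\{\theta_1,\dots,\theta_n\}$, bigraded by degree in the $x$-variables and degree in the $\theta$-variables, with the operator $df=\sum_{i=1}^n(\partial f/\partial x_i)\,\theta_i$. Let $I_{\mathcal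 A}$ be the smallest two-sided ideal of $\Omega_n$ that contains $J_{\mathcal A,1}$ and is closed under $d$, and let $\mathcal E_{\mathcal A}=\Omega_n/I_{\mathcal A}$, with bigraded Hilbert series $\mathrm{Hilb}(\mathcal E_{\mathcal A};q,t)=\sum_{i,j\ge0}\dim_{\mathbb C}(\mathcal E_{\mathcal A})_{i,j}\,q^it^j$. Then $$\mathrm{Hilb}(\mathcal E_{\mathcal A};q,t)\big|_{(q,t)=(q^2,q)}=\mathrm{Hilb}\bigl(\mathbb C[x_1,\dots,x_n]/J_{2\mathcal A,1};q\bigr).$$ A generic deformation of $2\mathcal A$ is an affine arrangement in $\mathbb R^n$ obtained by translating each of the $2m$ hyperplanes of $2\mathcal A$ so that any subfamily of the translated hyperplanes has a common point if and only if its family of normal vectors is linearly independent. Generic deformations of $2\mathcal A$ exist, the space $\mathcal E_{\mathcal A}$ is finite-dimensional, and every generic deformation of $2\mathcal A$ has finitely many regions (connected components of the complement in $\mathbb R^n$ of the union of its hyperplanes), their number being $\dim_{\mathbb C}\mathcal E_{\mathcal A}$. -/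

import Mathlib

open scoped TensorProduct

noncomputable section

namespace Superzonotopal

/-- A multiarrangement of linear hyperplanes in `K ^ n`, indexed by `ι` (repeats are allowed):
each hyperplane is given by a nonzero normal vector. -/
structure Multiarrangement (K : Type*) [Field K] (n : ℕ) (ι : Type*) where
  /-- the coefficient vector of the linear form cutting out the `i`-th hyperplane -/
  normal : ι → Fin n → K
  normal_ne_zero : ∀ i, normal i ≠ 0

namespace Multiarrangement

variable {K : Type*} [Field K] {n : ℕ} {ι : Type*}

/-- The `i`-th hyperplane, `{x | normal i ⬝ᵥ x = 0}`. -/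
def hyperplane (A : Multiarrangement K n ι) (i : ι) : Submodule K (Fin n → K) :=
  LinearMap.ker (dotProductBilin K K (A.normal i))

/-- The doubled multiarrangement: every hyperplane is taken twice. -/
def double (A : Multiarrangement K n ι) : Multiarrangement K n (ι ⊕ ι) where
  normal := Sum.elim A.normal A.normal
  normal_ne_zero := by
    rintro (i | i)
    · exact A.normal_ne_zero i
    · exact A.normal_ne_zero i

/-- The complexification of a real multiarrangement. -/
def complexify (A : Multiarrangement ℝ n ι) : Multiarrangement ℂ n ι where
  normal i j := (A.normal i j : ℂ)
  normal_ne_zero i h :=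
    A.normal_ne_zero i (funext fun j => Complex.ofReal_eq_zero.mp (congrFun h j))

/-- The number of indices `i` such that the line spanned by `v` is not contained in the `i`-th
hyperplane. -/
def rho (A : Multiarrangement K n ι) (v : Fin n → K) : ℕ :=
  Set.ncard {i | ¬ (Submodule.span K {v} ≤ A.hyperplane i)}

/-- The affine translate `{x | normal i ⬝ᵥ x = b i}` of the `i`-th hyperplane. -/
def affineHyperplane (A : Multiarrangement K n ι) (b : ι → K) (i : ι) : Set (Fin n → K) :=
  {x | A.normal i ⬝ᵥ x = b i}

/-- The affine arrangement of the translates `A.affineHyperplane b i` is a generic deformation of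
`A`: a finite subfamily of the translates has a common point if and only if its normal vectors are
linearly independent. -/
def IsGenericDeformation (A : Multiarrangement K n ι) (b : ι → K) : Prop :=
  ∀ S : Finset ι, (⋂ i ∈ S, A.affineHyperplane b i).Nonempty ↔
    LinearIndependent K (fun i : S => A.normal i)

/-- The complement in `ℝ ^ n` of the union of the affine hyperplanes `A.affineHyperplane b i`. -/
def affineComplement (A : Multiarrangement ℝ n ι) (b : ι → ℝ) : Set (Fin n → ℝ) :=
  (⋃ i, A.affineHyperplane b i)ᶜ

/-- The regions of the affine arrangement `A.affineHyperplane b`: the connected components of its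
complement. -/
def regions (A : Multiarrangement ℝ n ι) (b : ι → ℝ) : Set (Set (Fin n → ℝ)) :=
  (connectedComponentIn (A.affineComplement b)) '' (A.affineComplement b)

end Multiarrangement

/-- The linear form `v₁ x₁ + ⋯ + vₙ xₙ`. -/
def linearForm {n : ℕ} (v : Fin n → ℂ) : MvPolynomial (Fin n) ℂ :=
  ∑ i, MvPolynomial.C (v i) * MvPolynomial.X i

/-- The power ideal `J_{A,k}` of `ℂ[x₁, …, xₙ]`, generated by the powers `λ_L ^ (ρ_A(L) + k)` for
all lines `L = ℂ v` in `ℂ ^ n`. -/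
def powerIdeal {n : ℕ} {ι : Type*} (A : Multiarrangement ℂ n ι) (k : ℕ) :
    Ideal (MvPolynomial (Fin n) ℂ) :=
  Ideal.span {p | ∃ v : Fin n → ℂ, v ≠ 0 ∧ p = linearForm v ^ (A.rho v + k)}

/-- The superspace ring `Ωₙ = ℂ[x₁, …, xₙ] ⊗ ⋀{θ₁, …, θₙ}`. -/
abbrev Superspace (n : ℕ) : Type :=
  MvPolynomial (Fin n) ℂ ⊗[ℂ] ExteriorAlgebra ℂ (Fin n → ℂ)

/-- The fermionic generator `θᵢ` of the exterior algebra. -/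
def theta {n : ℕ} (i : Fin n) : ExteriorAlgebra ℂ (Fin n → ℂ) :=
  ExteriorAlgebra.ι ℂ (Pi.single i 1)

/-- The Euler operator `d f = ∑ᵢ (∂f/∂xᵢ) θᵢ`, that is
`d (p ⊗ ω) = ∑ᵢ (∂p/∂xᵢ) ⊗ (ω θᵢ)`. -/
def euler (n : ℕ) : Superspace n →ₗ[ℂ] Superspace n :=
  ∑ i : Fin n, TensorProduct.map (MvPolynomial.pderiv i).toLinearMap
    (LinearMap.mulRight ℂ (theta i))

/-- The bihomogeneous component of `Ωₙ` of bosonic degree `i` and fermionic degree `j`, namely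
the image of `ℂ[x]_i ⊗ ⋀^j`. -/
def bidegree (n i j : ℕ) : Submodule ℂ (Superspace n) :=
  LinearMap.range (TensorProduct.mapIncl (MvPolynomial.homogeneousSubmodule (Fin n) ℂ i)
    (⋀[ℂ]^j (Fin n → ℂ)))

/-- The differential closure of an ideal `J` of `ℂ[x₁, …, xₙ]`: the smallest two-sided ideal of
`Ωₙ` that is closed under `d` and contains `J`. -/
def differentialClosure {n : ℕ} (J : Ideal (MvPolynomial (Fin n) ℂ)) : Ideal (Superspace n) :=
  sInf {I | I.IsTwoSided ∧ (∀ f ∈ I, euler n f ∈ I) ∧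
    ∀ p ∈ J, p ⊗ₜ[ℂ] (1 : ExteriorAlgebra ℂ (Fin n → ℂ)) ∈ I}

/-- The superspace ideal `I_A`. -/
def superIdeal {n : ℕ} {ι : Type*} (A : Multiarrangement ℂ n ι) : Ideal (Superspace n) :=
  differentialClosure (powerIdeal A 1)

/-- The superspace external algebra `E_A = Ωₙ / I_A`. -/
abbrev SuperExternal {n : ℕ} {ι : Type*} (A : Multiarrangement ℂ n ι) : Type :=
  Superspace n ⧸ superIdeal A

/-- The Hilbert series `Hilb(ℂ[x₁, …, xₙ] / J; q)`; the degree `i` piece of the quotient is the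
image of the homogeneous polynomials of degree `i`. -/
def hilbPoly {n : ℕ} (J : Ideal (MvPolynomial (Fin n) ℂ)) : PowerSeries ℤ :=
  PowerSeries.mk fun i => (Module.finrank ℂ
    ((MvPolynomial.homogeneousSubmodule (Fin n) ℂ i).map
      ((Submodule.mkQ J).restrictScalars ℂ)) : ℤ)

/-- The bigraded Hilbert series `Hilb(Ωₙ / I; q, t)`, with `q` the variable `0` and `t` the
variable `1`; the bidegree `(i, j)` piece of the quotient is the image of `(Ωₙ)_{i,j}`. -/
def hilbSuper {n : ℕ} (I : Ideal (Superspace n)) : MvPowerSeries (Fin 2) ℤ :=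
  fun e => (Module.finrank ℂ
    ((bidegree n (e 0) (e 1)).map ((Submodule.mkQ I).restrictScalars ℂ)) : ℤ)

end Superzonotopal

end

noncomputable section

namespace Superzonotopal

variable {n : ℕ}

/-! The proof is a deletion–contraction argument. The family of ideals is enlarged to make it
inductive: for a list `l` of covectors and a subspace `C`, `superPower l C` is generated by `λ_v ^
(ρ v + 1)` and `λ_v ^ (ρ v) dλ_v` with `v` ranging over `C` only. For `C = ⊤` and `l` the forms of
the arrangement this is the ideal `I_A` (`superIdeal_eq`), because `d(λ ^ (ρ+1)) = (ρ+1) λ ^ ρ dλ`.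

For a covector `a`, the directional derivative `dBos a` maps `superPower (a :: l) C` onto
`superPower l C` (`dBos_mem_of_cons`, `exists_primitive_cons`). The main point is that its kernel
there equals the kernel of `dBos a` on `superPower l (C ⊓ ker a)` (`superPower_cons_inf_ker`). This
rests on an inverse-system description (`superPerp_eq`): `f` lies in `superPower (a :: l) C` exactly
when `f`, `dBos a f` and `dFer a f` all lie in `superPower l C`.

Taking Hilbert series gives, for `a` not vanishing on `C`, `Q(a :: l, C) = q Q(l, C) + (1 - q) Q(l,
C ⊓ ker a)` (`quotHilb_cons`), with `Q([], C) = ((1 + t) / (1 - q)) ^ codim C`. At `(q², q)` the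
base value becomes `(1 - q) ^ (-codim C)`, which is also its value at `(q, 0)`. The recursion with
`q²` in place of `q` is the recursion applied to `a` twice, since `q² + (1 - q²)` arises as `q(q +
(1 - q)) + (1 - q)` and the second copy of `a` is invisible on `ker a`. So specializing at `(q², q)`
equals doubling and setting `t = 0` (`specSq_quotHilb`), and the part with `t = 0` is the polynomial
quotient (`hilbPoly_eq`).

For `C = ⊤` the doubled series is the polynomial `countPoly`, so nonnegativity of the coefficients
forces the super quotient to be finite-dimensional, of dimension the value at `1`
(`finite_and_finrank_quotient`). That value obeys the recursion satisfied by the number of sign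
patterns of a generic deformation: a hyperplane either cuts a flat, adding the patterns of the
section, or misses it (`ncard_signs`). Sign patterns correspond to regions. -/

/-- The bosonic element `λ_v` of `Ωₙ`. -/
def bos (v : Fin n → ℂ) : Superspace n := linearForm v ⊗ₜ 1

/-- The fermionic element `dλ_v` of `Ωₙ`. -/
def fer (v : Fin n → ℂ) : Superspace n := 1 ⊗ₜ ExteriorAlgebra.ι ℂ v

/-- The derivation of `ℂ[x₁, …, xₙ]` with `λ_v ↦ a v`. -/
def polyDeriv (a : Module.Dual ℂ (Fin n → ℂ)) :
    Derivation ℂ (MvPolynomial (Fin n) ℂ) (MvPolynomial (Fin n) ℂ) :=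
  ∑ i, a (Pi.single i 1) • MvPolynomial.pderiv i

/-- The bosonic directional derivative on `Ωₙ`. -/
def dBos (a : Module.Dual ℂ (Fin n → ℂ)) : Superspace n →ₗ[ℂ] Superspace n :=
  LinearMap.rTensor _ (polyDeriv a).toLinearMap

/-- The fermionic contraction on `Ωₙ`. -/
def dFer (a : Module.Dual ℂ (Fin n → ℂ)) : Superspace n →ₗ[ℂ] Superspace n :=
  LinearMap.lTensor _ (CliffordAlgebra.contractLeft (Q := (0 : QuadraticForm ℂ (Fin n → ℂ))) a)

/-- The augmentation of `Ωₙ` that sets all variables to zero. -/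
def aug (n : ℕ) : Superspace n →ₐ[ℂ] ℂ :=
  Algebra.TensorProduct.lift (MvPolynomial.aeval 0) ExteriorAlgebra.algebraMapInv
    (fun _ _ => Commute.all _ _)

/-! ### Leibniz rules, commutation relations and induction on `Ωₙ`. -/

lemma polyDeriv_linearForm (a : Module.Dual ℂ (Fin n → ℂ)) (v : Fin n → ℂ) :
    polyDeriv a (linearForm v) = MvPolynomial.C (a v) := by
  have h : a v = ∑ i, v i * a (Pi.single i 1) := by
    conv_lhs => rw [pi_eq_sum_univ' v, map_sum]
    refine Finset.sum_congr rfl fun i _ => ?_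
    rw [map_smul, smul_eq_mul]
  have hp : ∀ i, MvPolynomial.pderiv i (linearForm v) = MvPolynomial.C (v i) := by
    intro i
    simp [linearForm, MvPolynomial.pderiv_X, Pi.single_apply]
  rw [polyDeriv, ← Derivation.coeFnAddMonoidHom_apply, map_sum, Finset.sum_apply, h, map_sum]
  refine Finset.sum_congr rfl fun i _ => ?_
  rw [Derivation.coeFnAddMonoidHom_apply, Derivation.smul_apply, hp, MvPolynomial.smul_eq_C_mul,
    ← MvPolynomial.C_mul, mul_comm]

lemma linearForm_single (i : Fin n) : linearForm (Pi.single i 1) = MvPolynomial.X i := by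
  rw [linearForm, Finset.sum_eq_single i]
  · simp
  · intro j _ hj; simp [hj]
  · simp

/-- The map `v ↦ λ_v` is linear. -/
def bosHom (n : ℕ) : (Fin n → ℂ) →ₗ[ℂ] Superspace n where
  toFun := bos
  map_add' v w := by
    simp only [bos, ← TensorProduct.add_tmul]
    simp [linearForm, add_mul, Finset.sum_add_distrib]
  map_smul' c v := by
    simp only [bos, TensorProduct.smul_tmul', RingHom.id_apply]
    congr 1
    simp [linearForm, Finset.smul_sum, mul_assoc, MvPolynomial.smul_eq_C_mul]

lemma bos_zero : bos (0 : Fin n → ℂ) = 0 := (bosHom n).map_zero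

lemma fer_add (v w : Fin n → ℂ) : fer (v + w) = fer v + fer w := by
  simp [fer, TensorProduct.tmul_add]

lemma fer_zero : fer (0 : Fin n → ℂ) = 0 := by simp [fer]

lemma superspace_mul_neg (f g : Superspace n) : f * -g = -(f * g) := by
  rw [eq_neg_iff_add_eq_zero, ← mul_add, neg_add_cancel, mul_zero]

lemma superspace_neg_mul (f g : Superspace n) : -f * g = -(f * g) := by
  rw [eq_neg_iff_add_eq_zero, ← add_mul, neg_add_cancel, zero_mul]

lemma superspace_mul_sub (f g h : Superspace n) : f * (g - h) = f * g - f * h := by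
  rw [sub_eq_add_neg, sub_eq_add_neg, mul_add, superspace_mul_neg]

lemma bos_mul_comm (v : Fin n → ℂ) (f : Superspace n) : bos v * f = f * bos v := by
  induction f using TensorProduct.induction_on with
  | zero => simp
  | tmul p w => simp [bos, mul_comm]
  | add f g hf hg => rw [mul_add, add_mul, hf, hg]

lemma fer_mul_self (v : Fin n → ℂ) : fer v * fer v = 0 := by
  simp [fer]

lemma fer_mul_fer (v w : Fin n → ℂ) : fer v * fer w = -(fer w * fer v) := by
  have h := fer_mul_self (v + w)
  rw [fer_add, add_mul, mul_add, mul_add, fer_mul_self, fer_mul_self, zero_add, add_zero] at h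
  exact eq_neg_of_add_eq_zero_left h

lemma dBos_one (a : Module.Dual ℂ (Fin n → ℂ)) : dBos a 1 = 0 := by
  simp [dBos, Algebra.TensorProduct.one_def]

lemma dFer_one (a : Module.Dual ℂ (Fin n → ℂ)) : dFer a 1 = 0 := by
  simp [dFer, Algebra.TensorProduct.one_def]

lemma dBos_bos_mul (a : Module.Dual ℂ (Fin n → ℂ)) (v : Fin n → ℂ) (f : Superspace n) :
    dBos a (bos v * f) = a v • f + bos v * dBos a f := by
  induction f using TensorProduct.induction_on with
  | zero => simp
  | tmul p w =>
    simp only [dBos, bos, Algebra.TensorProduct.tmul_mul_tmul, LinearMap.rTensor_tmul, one_mul,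
      Derivation.coeFn_coe, Derivation.leibniz,
      polyDeriv_linearForm, TensorProduct.smul_tmul', ← TensorProduct.add_tmul]
    congr 1
    simp only [smul_eq_mul, MvPolynomial.smul_eq_C_mul]
    ring
  | add f g hf hg => rw [mul_add, map_add, hf, hg, map_add, smul_add, mul_add]; abel

lemma dBos_fer_mul (a : Module.Dual ℂ (Fin n → ℂ)) (v : Fin n → ℂ) (f : Superspace n) :
    dBos a (fer v * f) = fer v * dBos a f := by
  induction f using TensorProduct.induction_on with
  | zero => simp
  | tmul p w => simp [dBos, fer]
  | add f g hf hg => rw [mul_add, map_add, hf, hg, map_add, mul_add]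

lemma dFer_bos_mul (a : Module.Dual ℂ (Fin n → ℂ)) (v : Fin n → ℂ) (f : Superspace n) :
    dFer a (bos v * f) = bos v * dFer a f := by
  induction f using TensorProduct.induction_on with
  | zero => simp
  | tmul p w => simp [dFer, bos]
  | add f g hf hg => rw [mul_add, map_add, hf, hg, map_add, mul_add]

lemma dFer_fer_mul (a : Module.Dual ℂ (Fin n → ℂ)) (v : Fin n → ℂ) (f : Superspace n) :
    dFer a (fer v * f) = a v • f - fer v * dFer a f := by
  induction f using TensorProduct.induction_on with
  | zero => simp
  | tmul p w =>
    simp only [dFer, fer, Algebra.TensorProduct.tmul_mul_tmul, one_mul, LinearMap.lTensor_tmul]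
    erw [CliffordAlgebra.contractLeft_ι_mul]
    rw [TensorProduct.tmul_sub, TensorProduct.tmul_smul]
  | add f g hf hg => rw [mul_add, map_add, hf, hg, map_add, smul_add, mul_add]; abel

lemma aug_bos_mul (v : Fin n → ℂ) (f : Superspace n) : aug n (bos v * f) = 0 := by
  rw [map_mul]
  simp [aug, bos, linearForm]

lemma aug_fer_mul (v : Fin n → ℂ) (f : Superspace n) : aug n (fer v * f) = 0 := by
  rw [map_mul]
  simp [aug, fer, ExteriorAlgebra.algebraMapInv]

/-- `Ωₙ` is generated by `1` under left multiplication by the elements `λ_v` and `dλ_v`. -/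
theorem superspace_induction {P : Superspace n → Prop} (one : P 1)
    (smul : ∀ (c : ℂ) f, P f → P (c • f)) (add : ∀ f g, P f → P g → P (f + g))
    (bos_mul : ∀ v f, P f → P (bos v * f)) (fer_mul : ∀ v f, P f → P (fer v * f))
    (f : Superspace n) : P f := by
  have h1 : ∀ w : ExteriorAlgebra ℂ (Fin n → ℂ), P (1 ⊗ₜ w) := by
    intro w
    induction w using CliffordAlgebra.left_induction with
    | algebraMap r =>
      have := smul r _ one
      rwa [Algebra.TensorProduct.one_def, ← TensorProduct.tmul_smul,
        ← Algebra.algebraMap_eq_smul_one] at this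
    | add x y hx hy => rw [TensorProduct.tmul_add]; exact add _ _ hx hy
    | ι_mul x m hx =>
      have := fer_mul m _ hx
      rwa [fer, Algebra.TensorProduct.tmul_mul_tmul, one_mul] at this
  have h2 : ∀ (p : MvPolynomial (Fin n) ℂ) (w : ExteriorAlgebra ℂ (Fin n → ℂ)), P (p ⊗ₜ w) := by
    intro p w
    induction p using MvPolynomial.induction_on with
    | C c =>
      have := smul c _ (h1 w)
      rwa [TensorProduct.smul_tmul', ← MvPolynomial.C_1, MvPolynomial.smul_eq_C_mul,
        ← MvPolynomial.C_mul, mul_one] at this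
    | add p q hp hq => rw [TensorProduct.add_tmul]; exact add _ _ hp hq
    | mul_X p i hp =>
      have := bos_mul (Pi.single i 1) _ hp
      rwa [bos, Algebra.TensorProduct.tmul_mul_tmul, one_mul, linearForm_single, mul_comm] at this
  induction f using TensorProduct.induction_on with
  | zero => simpa using smul 0 _ one
  | tmul p w => exact h2 p w
  | add f g hf hg => exact add _ _ hf hg

/-- Two linear maps on `Ωₙ` agree if they agree on `1` and this is propagated by left
multiplication by generators. -/
lemma superspace_hom_ext {E : Type*} [AddCommGroup E] [Module ℂ E] {S T : Superspace n →ₗ[ℂ] E}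
    (one : S 1 = T 1) (bos_mul : ∀ v f, S f = T f → S (bos v * f) = T (bos v * f))
    (fer_mul : ∀ v f, S f = T f → S (fer v * f) = T (fer v * f)) (f : Superspace n) :
    S f = T f :=
  superspace_induction (P := fun f => S f = T f) one (fun c f h => by simp [h])
    (fun f g hf hg => by simp [hf, hg]) bos_mul fer_mul f

lemma dBos_comm (a b : Module.Dual ℂ (Fin n → ℂ)) (f : Superspace n) :
    dBos a (dBos b f) = dBos b (dBos a f) := by
  refine superspace_hom_ext (S := dBos a ∘ₗ dBos b) (T := dBos b ∘ₗ dBos a) ?_ ?_ ?_ f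
  · simp [dBos_one]
  · intro v f h
    simp only [LinearMap.comp_apply] at h ⊢
    simp only [dBos_bos_mul, map_add, map_smul, h]; abel
  · intro v f h
    simp only [LinearMap.comp_apply] at h ⊢
    simp only [dBos_fer_mul, h]

lemma dBos_dFer (a b : Module.Dual ℂ (Fin n → ℂ)) (f : Superspace n) :
    dBos a (dFer b f) = dFer b (dBos a f) := by
  refine superspace_hom_ext (S := dBos a ∘ₗ dFer b) (T := dFer b ∘ₗ dBos a) ?_ ?_ ?_ f
  · simp [dBos_one, dFer_one]
  · intro v f h
    simp only [LinearMap.comp_apply] at h ⊢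
    simp only [dBos_bos_mul, dFer_bos_mul, map_add, map_smul, h]
  · intro v f h
    simp only [LinearMap.comp_apply] at h ⊢
    simp only [dBos_fer_mul, dFer_fer_mul, map_sub, map_smul, h]

lemma dFer_dFer (a b : Module.Dual ℂ (Fin n → ℂ)) (f : Superspace n) :
    dFer a (dFer b f) = -dFer b (dFer a f) := by
  refine superspace_hom_ext (S := dFer a ∘ₗ dFer b) (T := -(dFer b ∘ₗ dFer a)) ?_ ?_ ?_ f
  · simp [dFer_one]
  · intro v f h
    simp only [LinearMap.comp_apply, LinearMap.neg_apply] at h ⊢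
    simp only [dFer_bos_mul, h, superspace_mul_neg]
  · intro v f h
    simp only [LinearMap.comp_apply, LinearMap.neg_apply] at h ⊢
    simp only [dFer_fer_mul, map_sub, map_smul, h, superspace_mul_neg]; abel

lemma dFer_self (a : Module.Dual ℂ (Fin n → ℂ)) (f : Superspace n) : dFer a (dFer a f) = 0 := by
  have h := add_eq_zero_iff_eq_neg.mpr (dFer_dFer a a f)
  rw [← two_smul ℂ] at h
  exact (smul_eq_zero.mp h).resolve_left two_ne_zero

lemma dBos_add (a b : Module.Dual ℂ (Fin n → ℂ)) (f : Superspace n) :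
    dBos (a + b) f = dBos a f + dBos b f := by
  refine superspace_hom_ext (S := dBos (a + b)) (T := dBos a + dBos b) ?_ ?_ ?_ f
  · simp [dBos_one]
  · intro v f h
    simp only [LinearMap.add_apply] at h ⊢
    simp only [dBos_bos_mul, h, mul_add, LinearMap.add_apply, add_smul]; abel
  · intro v f h
    simp only [LinearMap.add_apply] at h ⊢
    simp only [dBos_fer_mul, h, mul_add]

lemma dBos_smul (c : ℂ) (a : Module.Dual ℂ (Fin n → ℂ)) (f : Superspace n) :
    dBos (c • a) f = c • dBos a f := by
  refine superspace_hom_ext (S := dBos (c • a)) (T := c • dBos a) ?_ ?_ ?_ f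
  · simp [dBos_one]
  · intro v f h
    simp only [LinearMap.smul_apply] at h ⊢
    simp only [dBos_bos_mul, h, smul_add, LinearMap.smul_apply, mul_smul_comm, smul_assoc]
  · intro v f h
    simp only [LinearMap.smul_apply] at h ⊢
    simp only [dBos_fer_mul, h, mul_smul_comm]

lemma dFer_add (a b : Module.Dual ℂ (Fin n → ℂ)) (f : Superspace n) :
    dFer (a + b) f = dFer a f + dFer b f := by
  refine superspace_hom_ext (S := dFer (a + b)) (T := dFer a + dFer b) ?_ ?_ ?_ f
  · simp [dFer_one]
  · intro v f h
    simp only [LinearMap.add_apply] at h ⊢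
    simp only [dFer_bos_mul, h, mul_add]
  · intro v f h
    simp only [LinearMap.add_apply] at h ⊢
    simp only [dFer_fer_mul, h, mul_add, LinearMap.add_apply, add_smul]; abel

lemma dFer_smul (c : ℂ) (a : Module.Dual ℂ (Fin n → ℂ)) (f : Superspace n) :
    dFer (c • a) f = c • dFer a f := by
  refine superspace_hom_ext (S := dFer (c • a)) (T := c • dFer a) ?_ ?_ ?_ f
  · simp [dFer_one]
  · intro v f h
    simp only [LinearMap.smul_apply] at h ⊢
    simp only [dFer_bos_mul, h, mul_smul_comm]
  · intro v f h
    simp only [LinearMap.smul_apply] at h ⊢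
    simp only [dFer_fer_mul, h, smul_sub, LinearMap.smul_apply, mul_smul_comm, smul_assoc]

lemma bos_pow_mul_comm (v : Fin n → ℂ) (k : ℕ) (f : Superspace n) :
    bos v ^ k * f = f * bos v ^ k :=
  (Commute.pow_left (show Commute (bos v) f from bos_mul_comm v f) k).eq

lemma dBos_bos_pow_mul (a : Module.Dual ℂ (Fin n → ℂ)) (v : Fin n → ℂ) (k : ℕ)
    (f : Superspace n) :
    dBos a (bos v ^ (k + 1) * f) =
      ((k + 1 : ℕ) * a v) • (bos v ^ k * f) + bos v ^ (k + 1) * dBos a f := by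
  induction k generalizing f with
  | zero => simp [dBos_bos_mul]
  | succ k ih =>
    rw [pow_succ', mul_assoc, dBos_bos_mul, ih, mul_add, mul_smul_comm, ← mul_assoc, ← pow_succ',
      ← mul_assoc, ← pow_succ', ← add_assoc, ← add_smul]
    congr 2
    push_cast
    ring

lemma dBos_bos_pow_mul_of_eq_zero {a : Module.Dual ℂ (Fin n → ℂ)} {v : Fin n → ℂ} (h : a v = 0)
    (k : ℕ) (f : Superspace n) : dBos a (bos v ^ k * f) = bos v ^ k * dBos a f := by
  cases k with
  | zero => simp
  | succ k => simp [dBos_bos_pow_mul, h, mul_zero, zero_smul, zero_add]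

lemma dFer_bos_pow_mul (a : Module.Dual ℂ (Fin n → ℂ)) (v : Fin n → ℂ) (k : ℕ)
    (f : Superspace n) : dFer a (bos v ^ k * f) = bos v ^ k * dFer a f := by
  induction k generalizing f with
  | zero => simp
  | succ k ih => rw [pow_succ, mul_assoc, ih, dFer_bos_mul, mul_assoc]

/-- Moving an arbitrary element past `dλ_v`. -/
lemma exists_mul_fer (f : Superspace n) : ∃ f', ∀ v, f * fer v = fer v * f' := by
  -- One `f'` serves every `v`: it is `f` with the sign of its fermionically odd part reversed.
  induction f using superspace_induction with
  | one => exact ⟨1, by simp⟩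
  | smul c f h =>
    obtain ⟨f', h⟩ := h
    exact ⟨c • f', fun v => by rw [smul_mul_assoc, mul_smul_comm, h]⟩
  | add f g hf hg =>
    obtain ⟨f', hf⟩ := hf; obtain ⟨g', hg⟩ := hg
    exact ⟨f' + g', fun v => by rw [add_mul, mul_add, hf, hg]⟩
  | bos_mul w f h =>
    obtain ⟨f', h⟩ := h
    exact ⟨bos w * f', fun v => by rw [mul_assoc, h, ← mul_assoc, ← mul_assoc, bos_mul_comm]⟩
  | fer_mul w f h =>
    obtain ⟨f', h⟩ := h
    exact ⟨-(fer w * f'), fun v => by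
      rw [mul_assoc, h, ← mul_assoc, fer_mul_fer, superspace_mul_neg, superspace_neg_mul,
        mul_assoc]⟩

/-! ### The bigrading of `Ωₙ`. -/

section

lemma tmul_mem_bidegree {i j : ℕ} {p : MvPolynomial (Fin n) ℂ}
    {w : ExteriorAlgebra ℂ (Fin n → ℂ)} (hp : p ∈ MvPolynomial.homogeneousSubmodule (Fin n) ℂ i)
    (hw : w ∈ ⋀[ℂ]^j (Fin n → ℂ)) : p ⊗ₜ[ℂ] w ∈ bidegree n i j :=
  ⟨⟨p, hp⟩ ⊗ₜ ⟨w, hw⟩, rfl⟩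

lemma bidegree_le {i j : ℕ} {N : Submodule ℂ (Superspace n)}
    (h : ∀ p ∈ MvPolynomial.homogeneousSubmodule (Fin n) ℂ i, ∀ w ∈ ⋀[ℂ]^j (Fin n → ℂ),
      p ⊗ₜ[ℂ] w ∈ N) : bidegree n i j ≤ N := by
  rintro _ ⟨t, rfl⟩
  induction t using TensorProduct.induction_on with
  | zero => simp
  | tmul p w => exact h p p.2 w w.2
  | add x y hx hy => rw [map_add]; exact N.add_mem hx hy

instance bidegree_finite (i j : ℕ) : Module.Finite ℂ (bidegree n i j) := by
  have : Module.Finite ℂ (MvPolynomial.homogeneousSubmodule (Fin n) ℂ i) :=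
    Module.Finite.iff_fg.mpr (MvPolynomial.homogeneousSubmodule_fg (σ := Fin n) (R := ℂ) i)
  rw [bidegree]
  infer_instance

lemma one_mem_bidegree : (1 : Superspace n) ∈ bidegree n 0 0 :=
  tmul_mem_bidegree (MvPolynomial.isHomogeneous_one _ _) (by simp)

lemma bos_mul_mem {i j : ℕ} (v : Fin n → ℂ) {f : Superspace n} (hf : f ∈ bidegree n i j) :
    bos v * f ∈ bidegree n (i + 1) j := by
  suffices h : bidegree n i j ≤ (bidegree n (i + 1) j).comap (LinearMap.mulLeft ℂ (bos v)) from
    h hf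
  refine bidegree_le fun p hp w hw => ?_
  have h1 : (linearForm v).IsHomogeneous 1 := by
    refine MvPolynomial.IsHomogeneous.sum _ _ _ fun k _ => ?_
    simpa using (MvPolynomial.isHomogeneous_C (Fin n) (v k)).mul (MvPolynomial.isHomogeneous_X ℂ k)
  rw [Submodule.mem_comap, LinearMap.mulLeft_apply, bos, Algebra.TensorProduct.tmul_mul_tmul,
    one_mul, add_comm i]
  exact tmul_mem_bidegree (h1.mul hp) hw

lemma fer_mul_mem {i j : ℕ} (v : Fin n → ℂ) {f : Superspace n} (hf : f ∈ bidegree n i j) :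
    fer v * f ∈ bidegree n i (j + 1) := by
  suffices h : bidegree n i j ≤ (bidegree n i (j + 1)).comap (LinearMap.mulLeft ℂ (fer v)) from
    h hf
  refine bidegree_le fun p hp w hw => ?_
  rw [Submodule.mem_comap, LinearMap.mulLeft_apply, fer, Algebra.TensorProduct.tmul_mul_tmul,
    one_mul]
  refine tmul_mem_bidegree hp ?_
  change _ ∈ LinearMap.range (ExteriorAlgebra.ι ℂ) ^ (j + 1)
  rw [pow_succ']
  exact Submodule.mul_mem_mul ⟨v, rfl⟩ hw

lemma dBos_mem {i j : ℕ} (a : Module.Dual ℂ (Fin n → ℂ)) {f : Superspace n}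
    (hf : f ∈ bidegree n (i + 1) j) : dBos a f ∈ bidegree n i j := by
  suffices h : bidegree n (i + 1) j ≤ (bidegree n i j).comap (dBos a) from h hf
  refine bidegree_le fun p hp w hw => ?_
  rw [Submodule.mem_comap, dBos, LinearMap.rTensor_tmul]
  refine tmul_mem_bidegree ?_ hw
  rw [Derivation.coeFn_coe, polyDeriv, ← Derivation.coeFnAddMonoidHom_apply, map_sum,
    Finset.sum_apply]
  exact Submodule.sum_mem _ fun k _ => Submodule.smul_mem _ _
    (MvPolynomial.IsHomogeneous.pderiv (n := i + 1) hp)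

lemma dBos_eq_zero {j : ℕ} (a : Module.Dual ℂ (Fin n → ℂ)) {f : Superspace n}
    (hf : f ∈ bidegree n 0 j) : dBos a f = 0 := by
  suffices h : bidegree n 0 j ≤ LinearMap.ker (dBos a) from h hf
  refine bidegree_le fun p hp w _ => ?_
  have hp' : p = MvPolynomial.C (p.coeff 0) := by
    rw [← MvPolynomial.totalDegree_eq_zero_iff_eq_C]
    exact Nat.le_zero.mp (MvPolynomial.IsHomogeneous.totalDegree_le hp)
  rw [LinearMap.mem_ker, dBos, LinearMap.rTensor_tmul, hp', Derivation.coeFn_coe,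
    MvPolynomial.derivation_C, TensorProduct.zero_tmul]

/-- The Leibniz rule for `ι v * y` leaves the term `ι v * (a ⌋ y)`, which has the right degree by
induction, except when `y` is a scalar and the contraction must vanish. Proving both cases together,
with `j = k + 1` explicit, avoids a truncated `j - 1`. -/
lemma contractLeft_exteriorPower (a : Module.Dual ℂ (Fin n → ℂ)) (j : ℕ)
    {w : ExteriorAlgebra ℂ (Fin n → ℂ)} (hw : w ∈ ⋀[ℂ]^j (Fin n → ℂ)) :
    (j = 0 → CliffordAlgebra.contractLeft (Q := (0 : QuadraticForm ℂ (Fin n → ℂ))) a w = 0) ∧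
    ∀ k, j = k + 1 → CliffordAlgebra.contractLeft (Q := (0 : QuadraticForm ℂ (Fin n → ℂ))) a w ∈
      ⋀[ℂ]^k (Fin n → ℂ) := by
  induction j generalizing w with
  | zero =>
    refine ⟨fun _ => ?_, fun k hk => by omega⟩
    obtain ⟨c, rfl⟩ : ∃ c, algebraMap ℂ _ c = w := by
      simpa [Submodule.mem_one] using hw
    exact CliffordAlgebra.contractLeft_algebraMap _ _ _
  | succ j ih =>
    refine ⟨fun h => by omega, fun k hk => ?_⟩
    obtain rfl : j = k := by omega
    change _ ∈ LinearMap.range (ExteriorAlgebra.ι ℂ) ^ (j + 1) at hw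
    rw [pow_succ'] at hw
    induction hw using Submodule.mul_induction_on' with
    | mem_mul_mem x hx y hy =>
      obtain ⟨v, rfl⟩ := hx
      erw [CliffordAlgebra.contractLeft_ι_mul]
      refine Submodule.sub_mem _ (Submodule.smul_mem _ _ hy) ?_
      obtain ⟨h0, h1⟩ := ih hy
      rcases j with _ | j
      · rw [h0 rfl, mul_zero]; exact Submodule.zero_mem _
      · change _ ∈ LinearMap.range (ExteriorAlgebra.ι ℂ) ^ (j + 1)
        rw [pow_succ']
        exact Submodule.mul_mem_mul ⟨v, rfl⟩ (h1 j rfl)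
    | add x _ y _ hx hy => rw [map_add]; exact Submodule.add_mem _ hx hy

lemma dFer_mem {i j : ℕ} (a : Module.Dual ℂ (Fin n → ℂ)) {f : Superspace n}
    (hf : f ∈ bidegree n i (j + 1)) : dFer a f ∈ bidegree n i j := by
  suffices h : bidegree n i (j + 1) ≤ (bidegree n i j).comap (dFer a) from h hf
  refine bidegree_le fun p hp w hw => ?_
  rw [Submodule.mem_comap, dFer, LinearMap.lTensor_tmul]
  exact tmul_mem_bidegree hp ((contractLeft_exteriorPower a _ hw).2 j rfl)

lemma dFer_eq_zero {i : ℕ} (a : Module.Dual ℂ (Fin n → ℂ)) {f : Superspace n}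
    (hf : f ∈ bidegree n i 0) : dFer a f = 0 := by
  suffices h : bidegree n i 0 ≤ LinearMap.ker (dFer a) from h hf
  refine bidegree_le fun p hp w hw => ?_
  rw [LinearMap.mem_ker, dFer, LinearMap.lTensor_tmul,
    (contractLeft_exteriorPower a _ hw).1 rfl, TensorProduct.tmul_zero]

/-- The projection of `Ωₙ` onto a bihomogeneous component. -/
def bidegreeProj (n : ℕ) (e : ℕ × ℕ) : Superspace n →ₗ[ℂ] Superspace n :=
  TensorProduct.map (MvPolynomial.homogeneousComponent e.1)
    (GradedAlgebra.proj (fun k : ℕ => ⋀[ℂ]^k (Fin n → ℂ)) e.2)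

lemma bidegreeProj_of_mem {i j : ℕ} {f : Superspace n} (hf : f ∈ bidegree n i j) (e : ℕ × ℕ) :
    bidegreeProj n e f = if e = (i, j) then f else 0 := by
  suffices h : bidegree n i j ≤ LinearMap.ker
      (bidegreeProj n e - if e = (i, j) then LinearMap.id else 0) by
    have := h hf
    rw [LinearMap.mem_ker, LinearMap.sub_apply, sub_eq_zero] at this
    rw [this]
    split_ifs <;> rfl
  refine bidegree_le fun p hp w hw => ?_
  rw [LinearMap.mem_ker, LinearMap.sub_apply, sub_eq_zero, bidegreeProj, TensorProduct.map_tmul,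
    MvPolynomial.homogeneousComponent_of_mem hp, GradedAlgebra.proj_apply]
  obtain ⟨k, l⟩ := e
  by_cases hi : k = i
  · by_cases hj : l = j
    · subst hi hj
      rw [DirectSum.decompose_of_mem_same (fun k : ℕ => ⋀[ℂ]^k (Fin n → ℂ)) hw]
      simp
    · rw [DirectSum.decompose_of_mem_ne (fun k : ℕ => ⋀[ℂ]^k (Fin n → ℂ)) hw (Ne.symm hj)]
      simp [hj]
  · simp [hi]

/-- `Ωₙ` is spanned by its bihomogeneous components. -/
theorem bidegree_induction {P : Superspace n → Prop}
    (add : ∀ f g, P f → P g → P (f + g)) (mem : ∀ i j, ∀ f ∈ bidegree n i j, P f)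
    (f : Superspace n) : P f := by
  have key : f ∈ ⨆ e : ℕ × ℕ, bidegree n e.1 e.2 := by
    have hmap : ∀ (T : Superspace n →ₗ[ℂ] Superspace n) (s : ℕ × ℕ → ℕ × ℕ),
        (∀ i j, ∀ g ∈ bidegree n i j, T g ∈ bidegree n (s (i, j)).1 (s (i, j)).2) →
        ∀ g ∈ ⨆ e : ℕ × ℕ, bidegree n e.1 e.2, T g ∈ ⨆ e : ℕ × ℕ, bidegree n e.1 e.2 := by
      intro T s h g hg
      suffices hle : ⨆ e : ℕ × ℕ, bidegree n e.1 e.2 ≤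
          (⨆ e : ℕ × ℕ, bidegree n e.1 e.2).comap T from hle hg
      refine iSup_le fun e g hg => ?_
      exact (le_iSup (fun e : ℕ × ℕ => bidegree n e.1 e.2) (s e)) (h e.1 e.2 g hg)
    induction f using superspace_induction with
    | one => exact (le_iSup (fun e : ℕ × ℕ => bidegree n e.1 e.2) (0, 0)) one_mem_bidegree
    | smul c f h => exact Submodule.smul_mem _ _ h
    | add f g hf hg => exact Submodule.add_mem _ hf hg
    | bos_mul v f h =>
      exact hmap (LinearMap.mulLeft ℂ (bos v)) (fun e => (e.1 + 1, e.2))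
          (fun i j g hg => bos_mul_mem v hg) f h
    | fer_mul v f h =>
      exact hmap (LinearMap.mulLeft ℂ (fer v)) (fun e => (e.1, e.2 + 1))
          (fun i j g hg => fer_mul_mem v hg) f h
  induction key using Submodule.iSup_induction' with
  | mem e x hx => exact mem _ _ x hx
  | zero => exact mem 0 0 0 (Submodule.zero_mem _)
  | add x y _ _ hx hy => exact add x y hx hy

lemma bidegreeProj_mem (e : ℕ × ℕ) (f : Superspace n) :
    bidegreeProj n e f ∈ bidegree n e.1 e.2 := by
  induction f using bidegree_induction with
  | add f g hf hg => rw [map_add]; exact Submodule.add_mem _ hf hg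
  | mem i j f hf =>
    rw [bidegreeProj_of_mem hf]
    split_ifs with h
    · subst h; exact hf
    · exact Submodule.zero_mem _

lemma exists_sum_bidegreeProj (f : Superspace n) :
    ∃ B : Finset (ℕ × ℕ), ∀ B', B ⊆ B' → ∑ e ∈ B', bidegreeProj n e f = f := by
  classical
  induction f using bidegree_induction with
  | add f g hf hg =>
    obtain ⟨B, hB⟩ := hf
    obtain ⟨D, hD⟩ := hg
    refine ⟨B ∪ D, fun B' h => ?_⟩
    simp only [map_add, Finset.sum_add_distrib]
    rw [hB _ (Finset.union_subset_left h), hD _ (Finset.union_subset_right h)]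
  | mem i j f hf =>
    refine ⟨{(i, j)}, fun B' h => ?_⟩
    simp only [bidegreeProj_of_mem hf]
    rw [Finset.sum_ite_eq', if_pos (h (Finset.mem_singleton_self _))]

lemma dBos_bidegreeProj (a : Module.Dual ℂ (Fin n → ℂ)) (i j : ℕ) (f : Superspace n) :
    dBos a (bidegreeProj n (i + 1, j) f) = bidegreeProj n (i, j) (dBos a f) := by
  induction f using bidegree_induction with
  | add f g hf hg => simp only [map_add, hf, hg]
  | mem k l f hf =>
    rw [bidegreeProj_of_mem hf]
    rcases k with _ | k
    · rw [dBos_eq_zero a hf, if_neg (by simp), map_zero, map_zero]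
    · rw [bidegreeProj_of_mem (dBos_mem a hf)]
      simp only [Prod.mk.injEq, Nat.add_right_cancel_iff]
      split_ifs <;> simp

lemma dFer_bidegreeProj (a : Module.Dual ℂ (Fin n → ℂ)) (i j : ℕ) (f : Superspace n) :
    dFer a (bidegreeProj n (i, j + 1) f) = bidegreeProj n (i, j) (dFer a f) := by
  induction f using bidegree_induction with
  | add f g hf hg => simp only [map_add, hf, hg]
  | mem k l f hf =>
    rw [bidegreeProj_of_mem hf]
    rcases l with _ | l
    · rw [dFer_eq_zero a hf, if_neg (by simp), map_zero, map_zero]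
    · rw [bidegreeProj_of_mem (dFer_mem a hf)]
      simp only [Prod.mk.injEq, Nat.add_right_cancel_iff]
      split_ifs <;> simp

lemma eq_aug_smul_one {f : Superspace n} (hf : f ∈ bidegree n 0 0) : f = aug n f • 1 := by
  suffices h : bidegree n 0 0 ≤ LinearMap.ker
      (LinearMap.id - (aug n).toLinearMap.smulRight (1 : Superspace n)) by
    have := h hf
    rwa [LinearMap.mem_ker, LinearMap.sub_apply, sub_eq_zero] at this
  refine bidegree_le fun p hp w hw => ?_
  have hp' : p = MvPolynomial.C (p.coeff 0) := by
    rw [← MvPolynomial.totalDegree_eq_zero_iff_eq_C]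
    exact Nat.le_zero.mp (MvPolynomial.IsHomogeneous.totalDegree_le hp)
  obtain ⟨c, rfl⟩ : ∃ c, algebraMap ℂ _ c = w := by
    simpa [Submodule.mem_one] using hw
  rw [LinearMap.mem_ker, LinearMap.sub_apply, sub_eq_zero, LinearMap.id_apply, hp',
    ← MvPolynomial.algebraMap_eq, Algebra.algebraMap_eq_smul_one, Algebra.algebraMap_eq_smul_one,
    ← TensorProduct.smul_tmul', TensorProduct.tmul_smul, ← Algebra.TensorProduct.one_def]
  simp [smul_smul]

end

section

/-! ### The degree operator -/

lemma bidegreeProj_bos_mul (v : Fin n → ℂ) (i j : ℕ) (f : Superspace n) :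
    bidegreeProj n (i + 1, j) (bos v * f) = bos v * bidegreeProj n (i, j) f ∧
      bidegreeProj n (0, j) (bos v * f) = 0 := by
  induction f using bidegree_induction with
  | add f g hf hg => simp only [map_add, mul_add, hf.1, hf.2, hg.1, hg.2, add_zero, and_self]
  | mem k l f hf =>
    rw [bidegreeProj_of_mem hf, bidegreeProj_of_mem (bos_mul_mem v hf),
      bidegreeProj_of_mem (bos_mul_mem v hf)]
    simp only [Prod.mk.injEq, Nat.add_right_cancel_iff]
    constructor
    · split_ifs <;> simp
    · simp

lemma bidegreeProj_fer_mul (v : Fin n → ℂ) (i j : ℕ) (f : Superspace n) :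
    bidegreeProj n (i, j + 1) (fer v * f) = fer v * bidegreeProj n (i, j) f ∧
      bidegreeProj n (i, 0) (fer v * f) = 0 := by
  induction f using bidegree_induction with
  | add f g hf hg => simp only [map_add, mul_add, hf.1, hf.2, hg.1, hg.2, add_zero, and_self]
  | mem k l f hf =>
    rw [bidegreeProj_of_mem hf, bidegreeProj_of_mem (fer_mul_mem v hf),
      bidegreeProj_of_mem (fer_mul_mem v hf)]
    simp only [Prod.mk.injEq, Nat.add_right_cancel_iff]
    constructor
    · split_ifs <;> simp
    · simp

/-- The operator acting as `i + j` on the component of bidegree `(i, j)`. -/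
def degreeOp (n : ℕ) : Superspace n →ₗ[ℂ] Superspace n :=
  ∑ k : Fin n, (LinearMap.mulLeft ℂ (bos (Pi.single k 1)) ∘ₗ dBos (LinearMap.proj k) +
    LinearMap.mulLeft ℂ (fer (Pi.single k 1)) ∘ₗ dFer (LinearMap.proj k))

lemma degreeOp_apply (f : Superspace n) : degreeOp n f =
    ∑ k : Fin n, (bos (Pi.single k 1) * dBos (LinearMap.proj k) f +
      fer (Pi.single k 1) * dFer (LinearMap.proj k) f) := by
  simp [degreeOp]

lemma bos_eq_sum (v : Fin n → ℂ) : bos v = ∑ k, v k • bos (Pi.single k 1) := by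
  change bosHom n v = ∑ k, v k • bosHom n (Pi.single k 1)
  conv_lhs => rw [pi_eq_sum_univ' v, map_sum]
  exact Finset.sum_congr rfl fun k _ => (bosHom n).map_smul _ _

lemma fer_eq_sum (v : Fin n → ℂ) : fer v = ∑ k, v k • fer (Pi.single k 1) := by
  simp only [fer, ← TensorProduct.tmul_smul, ← TensorProduct.tmul_sum]
  conv_lhs => rw [pi_eq_sum_univ' v, map_sum]
  simp only [map_smul]

/-- Euler's identity: the commutator of the degree operator with a generator is that generator,
since `∑ (v k) x_k = λ_v`. -/
lemma degreeOp_bos_mul (v : Fin n → ℂ) (f : Superspace n) :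
    degreeOp n (bos v * f) = bos v * f + bos v * degreeOp n f := by
  simp only [degreeOp_apply, dBos_bos_mul, dFer_bos_mul, Finset.mul_sum]
  conv_rhs => rw [bos_eq_sum v, Finset.sum_mul, ← bos_eq_sum v]
  rw [← Finset.sum_add_distrib]
  refine Finset.sum_congr rfl fun k _ => ?_
  rw [mul_add, mul_add, mul_smul_comm, smul_mul_assoc, LinearMap.proj_apply, ← mul_assoc,
    ← mul_assoc, ← bos_mul_comm v (bos _), ← bos_mul_comm v (fer _), mul_assoc, mul_assoc,
    add_assoc]

lemma degreeOp_fer_mul (v : Fin n → ℂ) (f : Superspace n) :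
    degreeOp n (fer v * f) = fer v * f + fer v * degreeOp n f := by
  simp only [degreeOp_apply, dBos_fer_mul, dFer_fer_mul, Finset.mul_sum]
  conv_rhs => rw [fer_eq_sum v, Finset.sum_mul, ← fer_eq_sum v]
  rw [← Finset.sum_add_distrib]
  refine Finset.sum_congr rfl fun k _ => ?_
  rw [superspace_mul_sub, mul_add, mul_smul_comm, smul_mul_assoc, LinearMap.proj_apply,
    ← mul_assoc, ← mul_assoc, bos_mul_comm _ (fer v), fer_mul_fer _ v, superspace_neg_mul,
    mul_assoc, mul_assoc]
  abel

lemma degreeOp_of_mem {i j : ℕ} {f : Superspace n} (hf : f ∈ bidegree n i j) :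
    degreeOp n f = ((i + j : ℕ) : ℂ) • f := by
  have key : ∀ f : Superspace n, ∀ i j, degreeOp n (bidegreeProj n (i, j) f) =
      ((i + j : ℕ) : ℂ) • bidegreeProj n (i, j) f := by
    intro f
    induction f using superspace_induction with
    | one =>
      intro i j
      rw [bidegreeProj_of_mem one_mem_bidegree]
      split_ifs with h
      · simp only [Prod.mk.injEq] at h
        obtain ⟨rfl, rfl⟩ := h
        simp [degreeOp_apply, dBos_one, dFer_one]
      · simp
    | smul c f h => intro i j; rw [map_smul, map_smul, h, smul_comm]
    | add f g hf hg => intro i j; rw [map_add, map_add, hf, hg, smul_add]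
    | bos_mul v f h =>
      rintro (_ | i) j
      · rw [(bidegreeProj_bos_mul v 0 j f).2]; simp
      · rw [(bidegreeProj_bos_mul v i j f).1, degreeOp_bos_mul, h, mul_smul_comm]
        nth_rewrite 1 [← one_smul ℂ (bos v * _)]
        rw [← add_smul]
        congr 1
        push_cast
        ring
    | fer_mul v f h =>
      rintro i (_ | j)
      · rw [(bidegreeProj_fer_mul v i 0 f).2]; simp
      · rw [(bidegreeProj_fer_mul v i j f).1, degreeOp_fer_mul, h, mul_smul_comm]
        nth_rewrite 1 [← one_smul ℂ (fer v * _)]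
        rw [← add_smul]
        congr 1
        push_cast
        ring
  have := key f i j
  rwa [bidegreeProj_of_mem hf, if_pos rfl] at this

lemma bidegreeProj_degreeOp (i j : ℕ) (f : Superspace n) :
    bidegreeProj n (i, j) (degreeOp n f) = ((i + j : ℕ) : ℂ) • bidegreeProj n (i, j) f := by
  induction f using bidegree_induction with
  | add f g hf hg => simp only [map_add, hf, hg, smul_add]
  | mem k l f hf =>
    rw [degreeOp_of_mem hf, map_smul, bidegreeProj_of_mem hf]
    split_ifs with h
    · simp only [Prod.mk.injEq] at h
      rw [h.1, h.2]
    · simp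

lemma eq_zero_of_bidegreeProj {f : Superspace n} (h : ∀ e, bidegreeProj n e f = 0) : f = 0 := by
  obtain ⟨B, hB⟩ := exists_sum_bidegreeProj f
  rw [← hB B subset_rfl]
  exact Finset.sum_eq_zero fun e _ => h e

/-- An element of `Ωₙ` is zero if it and all its iterated derivatives vanish at the origin. -/
lemma eq_bot_of_stable {M : Submodule ℂ (Superspace n)}
    (hM : ∀ f ∈ M, ∀ a, dBos a f ∈ M ∧ dFer a f ∈ M) (haug : ∀ f ∈ M, aug n f = 0) : M = ⊥ := by
  -- Induction on a strict bound for the total degree: the derivatives of `f` have smaller degree,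
  -- so they vanish by induction. Then the degree operator kills `f`, in characteristic zero `f` is
  -- a constant, and the constant is `aug n f = 0`.
  have key : ∀ d : ℕ, ∀ f ∈ M, (∀ i j, d ≤ i + j → bidegreeProj n (i, j) f = 0) → f = 0 := by
    intro d
    induction d with
    | zero => exact fun f _ h => eq_zero_of_bidegreeProj fun e => h e.1 e.2 (Nat.zero_le _)
    | succ d ih =>
      intro f hf h
      have hb : ∀ a, dBos a f = 0 := fun a => ih _ (hM f hf a).1 fun i j hij => by
        rw [← dBos_bidegreeProj, h _ _ (by omega), map_zero]
      have hc : ∀ a, dFer a f = 0 := fun a => ih _ (hM f hf a).2 fun i j hij => by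
        rw [← dFer_bidegreeProj, h _ _ (by omega), map_zero]
      have hN : degreeOp n f = 0 := by simp [degreeOp_apply, hb, hc]
      have hz : ∀ i j, i + j ≠ 0 → bidegreeProj n (i, j) f = 0 := by
        intro i j hij
        have := bidegreeProj_degreeOp i j f
        rw [hN, map_zero, eq_comm, smul_eq_zero] at this
        exact this.resolve_left (Nat.cast_ne_zero.mpr hij)
      have h0 : bidegreeProj n (0, 0) f = f := by
        obtain ⟨B, hB⟩ := exists_sum_bidegreeProj f
        conv_rhs => rw [← hB (insert (0, 0) B) (Finset.subset_insert _ _)]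
        rw [Finset.sum_eq_single (0, 0)]
        · rintro ⟨i, j⟩ _ hij
          refine hz i j fun h0 => hij ?_
          rw [Prod.mk.injEq]; omega
        · intro h; exact absurd (Finset.mem_insert_self _ _) h
      have hmem := bidegreeProj_mem (0, 0) f
      rw [h0] at hmem
      rw [eq_aug_smul_one hmem, haug f hf, zero_smul]
  rw [eq_bot_iff]
  intro f hf
  obtain ⟨B, hB⟩ := exists_sum_bidegreeProj f
  refine key (B.sup (fun e => e.1 + e.2) + 1) f hf fun i j hij => ?_
  have hnot : (i, j) ∉ B := fun h => by
    have := Finset.le_sup (f := fun e : ℕ × ℕ => e.1 + e.2) h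
    simp only at this
    omega
  have h1 := hB B subset_rfl
  have h2 := hB (insert (i, j) B) (Finset.subset_insert _ _)
  rw [Finset.sum_insert hnot, h1] at h2
  simpa using h2

/-! ### The ideals attached to a list of covectors -/

/-- The number of covectors in the list `l` that do not vanish at `v`. -/
def rhoList (l : List (Module.Dual ℂ (Fin n → ℂ))) (v : Fin n → ℂ) : ℕ :=
  (l.map fun a => if a v = 0 then 0 else 1).sum

lemma rhoList_cons_of_eq_zero {a : Module.Dual ℂ (Fin n → ℂ)} {v : Fin n → ℂ} (h : a v = 0)
    (l : List (Module.Dual ℂ (Fin n → ℂ))) : rhoList (a :: l) v = rhoList l v := by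
  simp [rhoList, h]

lemma rhoList_cons_of_ne_zero {a : Module.Dual ℂ (Fin n → ℂ)} {v : Fin n → ℂ} (h : a v ≠ 0)
    (l : List (Module.Dual ℂ (Fin n → ℂ))) : rhoList (a :: l) v = rhoList l v + 1 := by
  simp [rhoList, h, add_comm]

/-- The span of the multiples of `λ_v ^ (ρ v + 1)` and `λ_v ^ (ρ v) dλ_v` for `v` in the
subspace `C`, where `ρ` counts the covectors of the list `l` that do not vanish at `v`. -/
def superPower (l : List (Module.Dual ℂ (Fin n → ℂ))) (C : Submodule ℂ (Fin n → ℂ)) :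
    Submodule ℂ (Superspace n) :=
  Submodule.span ℂ {f | ∃ v ∈ C, ∃ g, f = bos v ^ (rhoList l v + 1) * g ∨
    f = bos v ^ rhoList l v * (fer v * g)}

variable {a : Module.Dual ℂ (Fin n → ℂ)} {l : List (Module.Dual ℂ (Fin n → ℂ))}
  {C : Submodule ℂ (Fin n → ℂ)}

lemma superPower_le {N : Submodule ℂ (Superspace n)}
    (hb : ∀ v ∈ C, ∀ g, bos v ^ (rhoList l v + 1) * g ∈ N)
    (hf : ∀ v ∈ C, ∀ g, bos v ^ rhoList l v * (fer v * g) ∈ N) : superPower l C ≤ N := by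
  refine Submodule.span_le.mpr ?_
  rintro _ ⟨v, hv, g, rfl | rfl⟩
  · exact hb v hv g
  · exact hf v hv g

lemma bos_pow_mul_mem {v : Fin n → ℂ} (hv : v ∈ C) {k : ℕ} (hk : rhoList l v + 1 ≤ k)
    (g : Superspace n) : bos v ^ k * g ∈ superPower l C := by
  obtain ⟨m, rfl⟩ := Nat.exists_eq_add_of_le hk
  rw [pow_add, mul_assoc]
  exact Submodule.subset_span ⟨v, hv, _, Or.inl rfl⟩

lemma bos_pow_mul_fer_mul_mem {v : Fin n → ℂ} (hv : v ∈ C) {k : ℕ} (hk : rhoList l v ≤ k)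
    (g : Superspace n) : bos v ^ k * (fer v * g) ∈ superPower l C := by
  obtain ⟨m, rfl⟩ := Nat.exists_eq_add_of_le hk
  rw [pow_add, mul_assoc, bos_pow_mul_comm v m, mul_assoc]
  exact Submodule.subset_span ⟨v, hv, _, Or.inr rfl⟩

lemma superPower_mul_right {f : Superspace n} (hf : f ∈ superPower l C) (h : Superspace n) :
    f * h ∈ superPower l C := by
  suffices key : superPower l C ≤ (superPower l C).comap (LinearMap.mulRight ℂ h) from key hf
  refine superPower_le (fun v hv g => ?_) (fun v hv g => ?_)
  · rw [Submodule.mem_comap, LinearMap.mulRight_apply, mul_assoc]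
    exact bos_pow_mul_mem hv le_rfl _
  · rw [Submodule.mem_comap, LinearMap.mulRight_apply, mul_assoc, mul_assoc]
    exact bos_pow_mul_fer_mul_mem hv le_rfl _

/-- `λ_v` is central and `dλ_v` can be moved past `h` after twisting `h` by a sign, so the span of
right multiples is also a left ideal. -/
lemma superPower_mul_left {f : Superspace n} (hf : f ∈ superPower l C) (h : Superspace n) :
    h * f ∈ superPower l C := by
  suffices key : superPower l C ≤ (superPower l C).comap (LinearMap.mulLeft ℂ h) from key hf
  obtain ⟨h', hh⟩ := exists_mul_fer h
  refine superPower_le (fun v hv g => ?_) (fun v hv g => ?_)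
  · rw [Submodule.mem_comap, LinearMap.mulLeft_apply, ← mul_assoc, ← bos_pow_mul_comm, mul_assoc]
    exact bos_pow_mul_mem hv le_rfl _
  · rw [Submodule.mem_comap, LinearMap.mulLeft_apply, ← mul_assoc, ← bos_pow_mul_comm, mul_assoc,
      ← mul_assoc h, hh, mul_assoc]
    exact bos_pow_mul_fer_mul_mem hv le_rfl _

lemma superPower_mono {D : Submodule ℂ (Fin n → ℂ)} (h : C ≤ D) :
    superPower l C ≤ superPower l D :=
  superPower_le (fun _ hv _ => bos_pow_mul_mem (h hv) le_rfl _)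
    (fun _ hv _ => bos_pow_mul_fer_mul_mem (h hv) le_rfl _)

lemma rhoList_le_cons (a : Module.Dual ℂ (Fin n → ℂ)) (l : List (Module.Dual ℂ (Fin n → ℂ)))
    (v : Fin n → ℂ) : rhoList l v ≤ rhoList (a :: l) v := by
  simp [rhoList]

lemma superPower_cons_le : superPower (a :: l) C ≤ superPower l C :=
  superPower_le
    (fun v hv _ => bos_pow_mul_mem hv (Nat.add_le_add_right (rhoList_le_cons a l v) 1) _)
    (fun v hv _ => bos_pow_mul_fer_mul_mem hv (rhoList_le_cons a l v) _)

lemma superPower_le_cons (h : C ≤ LinearMap.ker a) : superPower l C ≤ superPower (a :: l) C :=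
  superPower_le
    (fun v hv _ => bos_pow_mul_mem hv (by rw [rhoList_cons_of_eq_zero (h hv)]) _)
    (fun v hv _ => bos_pow_mul_fer_mul_mem hv (by rw [rhoList_cons_of_eq_zero (h hv)]) _)

lemma superPower_inf_ker_le_cons :
    superPower l (C ⊓ LinearMap.ker a) ≤ superPower (a :: l) C :=
  (superPower_le_cons inf_le_right).trans (superPower_mono inf_le_left)

/-- If `a v ≠ 0`, differentiation lowers the exponent of `λ_v` by one, exactly as dropping `a`
lowers `ρ v`. If `a v = 0`, then `λ_v` is a constant for `dBos a` and `ρ v` does not change. -/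
lemma dBos_mem_of_cons {f : Superspace n} (hf : f ∈ superPower (a :: l) C) :
    dBos a f ∈ superPower l C := by
  suffices key : superPower (a :: l) C ≤ (superPower l C).comap (dBos a) from key hf
  refine superPower_le (fun v hv g => ?_) (fun v hv g => ?_) <;> rw [Submodule.mem_comap] <;>
    by_cases h : a v = 0
  · rw [rhoList_cons_of_eq_zero h, dBos_bos_pow_mul_of_eq_zero h]
    exact bos_pow_mul_mem hv le_rfl _
  · rw [rhoList_cons_of_ne_zero h, dBos_bos_pow_mul]
    exact Submodule.add_mem _ (Submodule.smul_mem _ _ (bos_pow_mul_mem hv le_rfl _))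
      (bos_pow_mul_mem hv (by omega) _)
  · rw [rhoList_cons_of_eq_zero h, dBos_bos_pow_mul_of_eq_zero h, dBos_fer_mul]
    exact bos_pow_mul_fer_mul_mem hv le_rfl _
  · rw [rhoList_cons_of_ne_zero h, dBos_bos_pow_mul]
    exact Submodule.add_mem _ (Submodule.smul_mem _ _ (bos_pow_mul_fer_mul_mem hv le_rfl _))
      (bos_pow_mul_mem hv le_rfl _)

/-- Contracting `λ_v ^ ρ dλ_v` loses the factor `dλ_v`, but only when `a v ≠ 0`; then the exponent
is already one more than `ρ v` for the shorter list, so a bosonic generator remains. -/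
lemma dFer_mem_of_cons {f : Superspace n} (hf : f ∈ superPower (a :: l) C) :
    dFer a f ∈ superPower l C := by
  suffices key : superPower (a :: l) C ≤ (superPower l C).comap (dFer a) from key hf
  refine superPower_le (fun v hv g => ?_) (fun v hv g => ?_)
  · rw [Submodule.mem_comap, dFer_bos_pow_mul]
    exact superPower_cons_le (bos_pow_mul_mem (l := a :: l) hv le_rfl _)
  · rw [Submodule.mem_comap, dFer_bos_pow_mul, dFer_fer_mul, superspace_mul_sub]
    refine Submodule.sub_mem _ ?_
      (superPower_cons_le (bos_pow_mul_fer_mul_mem (l := a :: l) hv le_rfl _))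
    by_cases h : a v = 0
    · rw [h, zero_smul, mul_zero]; exact Submodule.zero_mem _
    · rw [rhoList_cons_of_ne_zero h]
      exact bos_pow_mul_mem hv le_rfl _

/-- A covector vanishing on `C` can be prepended to `l` without changing the ideal. -/
lemma dBos_mem_superPower (h : C ≤ LinearMap.ker a) {f : Superspace n}
    (hf : f ∈ superPower l C) : dBos a f ∈ superPower l C :=
  dBos_mem_of_cons (superPower_le_cons h hf)

lemma dFer_mem_superPower (h : C ≤ LinearMap.ker a) {f : Superspace n}
    (hf : f ∈ superPower l C) : dFer a f ∈ superPower l C :=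
  dFer_mem_of_cons (superPower_le_cons h hf)

lemma aug_superPower {f : Superspace n} (hf : f ∈ superPower l C) : aug n f = 0 := by
  suffices key : superPower l C ≤ LinearMap.ker (aug n).toLinearMap from key hf
  refine superPower_le (fun v hv g => ?_) (fun v hv g => ?_)
  · rw [LinearMap.mem_ker, pow_succ', mul_assoc]
    exact aug_bos_mul _ _
  · rw [LinearMap.mem_ker, AlgHom.toLinearMap_apply, map_mul, aug_fer_mul, mul_zero]

/-! ### Primitives -/

/-- Integration by parts in the direction dual to `λ_v`. -/
lemma exists_primitive_bos_pow {v : Fin n → ℂ} (hv : a v ≠ 0) (k : ℕ) (g : Superspace n) :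
    ∃ F, dBos a (bos v ^ (k + 1) * F) = bos v ^ k * g := by
  induction g using bidegree_induction with
  | add f g hf hg =>
    obtain ⟨F, hF⟩ := hf
    obtain ⟨G, hG⟩ := hg
    exact ⟨F + G, by rw [mul_add, mul_add, map_add, hF, hG]⟩
  | mem i j g hg =>
    have hk : ∀ k : ℕ, ((k + 1 : ℕ) : ℂ) * a v ≠ 0 := fun k =>
      mul_ne_zero (Nat.cast_ne_zero.mpr k.succ_ne_zero) hv
    induction i generalizing g k with
    | zero =>
      refine ⟨(((k + 1 : ℕ) : ℂ) * a v)⁻¹ • g, ?_⟩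
      rw [dBos_bos_pow_mul, map_smul, dBos_eq_zero a hg, mul_smul_comm, smul_smul,
        mul_inv_cancel₀ (hk k), one_smul, smul_zero, mul_zero, add_zero]
    | succ i ih =>
      -- Up to the factor `(k + 1) a v`, the element `λ ^ (k+1) g` has derivative `λ ^ k g` plus the
      -- error `λ ^ (k+1) dBos a g`. The error has a cofactor of lower bosonic degree, so induction
      -- with `k + 1` gives it the primitive `λ ^ (k+2) F`, which is subtracted.
      obtain ⟨F, hF⟩ := ih (k + 1) (dBos a g) (dBos_mem a hg)
      refine ⟨(((k + 1 : ℕ) : ℂ) * a v)⁻¹ • (g - bos v * F), ?_⟩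
      rw [mul_smul_comm, map_smul, superspace_mul_sub, map_sub, ← mul_assoc _ (bos v),
        ← pow_succ, hF, dBos_bos_pow_mul, add_sub_cancel_right, smul_smul, inv_mul_cancel₀ (hk k),
        one_smul]

lemma exists_dBos_eq (ha : a ≠ 0) (g : Superspace n) : ∃ F, dBos a F = g := by
  obtain ⟨v, hv⟩ : ∃ v, a v ≠ 0 := by
    by_contra! h
    exact ha (LinearMap.ext h)
  obtain ⟨F, hF⟩ := exists_primitive_bos_pow hv 0 g
  exact ⟨_, by rw [hF, pow_zero, one_mul]⟩

/-- When `a v ≠ 0`, a primitive of a multiple of `λ_v ^ k` can be chosen divisible by `λ_v ^ (k+1)`,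
matching the growth of `ρ v`. When `a v = 0`, only the cofactor has to be integrated. -/
lemma exists_primitive_cons (ha : a ≠ 0) {h : Superspace n} (hh : h ∈ superPower l C) :
    ∃ F ∈ superPower (a :: l) C, dBos a F = h := by
  suffices key : superPower l C ≤ (superPower (a :: l) C).map (dBos a) from key hh
  refine superPower_le (fun v hv g => ?_) (fun v hv g => ?_) <;> by_cases h : a v = 0
  · obtain ⟨G, hG⟩ := exists_dBos_eq ha g
    refine ⟨_, bos_pow_mul_mem hv le_rfl G, ?_⟩
    rw [rhoList_cons_of_eq_zero h, dBos_bos_pow_mul_of_eq_zero h, hG]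
  · obtain ⟨F, hF⟩ := exists_primitive_bos_pow h (rhoList l v + 1) g
    exact ⟨_, bos_pow_mul_mem hv (by rw [rhoList_cons_of_ne_zero h]) F, hF⟩
  · obtain ⟨G, hG⟩ := exists_dBos_eq ha g
    refine ⟨_, bos_pow_mul_fer_mul_mem hv le_rfl G, ?_⟩
    rw [rhoList_cons_of_eq_zero h, dBos_bos_pow_mul_of_eq_zero h, dBos_fer_mul, hG]
  · obtain ⟨F, hF⟩ := exists_primitive_bos_pow h (rhoList l v) g
    refine ⟨_, bos_pow_mul_fer_mul_mem hv (k := rhoList l v + 1)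
      (by rw [rhoList_cons_of_ne_zero h]) F, ?_⟩
    rw [bos_pow_mul_comm, mul_assoc, dBos_fer_mul, ← bos_pow_mul_comm, hF, ← mul_assoc,
      ← bos_pow_mul_comm, mul_assoc]

lemma exists_primitive_inf_ker (ha : a ≠ 0) {h : Superspace n}
    (hh : h ∈ superPower l (C ⊓ LinearMap.ker a)) :
    ∃ F ∈ superPower l (C ⊓ LinearMap.ker a), dBos a F = h := by
  obtain ⟨F, hF, rfl⟩ := exists_primitive_cons ha hh
  exact ⟨F, superPower_cons_le hF, rfl⟩

/-! ### Inverse systems -/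

/-- Modulo multiples of `a`, a covector vanishing on `C ⊓ ker a` vanishes on `C`. Derivatives along
the larger space of covectors thus reduce to those along covectors of `C` and along `a` itself. -/
lemma le_ker_sub_smul {b : Module.Dual ℂ (Fin n → ℂ)} {v : Fin n → ℂ} (hv : v ∈ C)
    (hav : a v = 1) (hb : C ⊓ LinearMap.ker a ≤ LinearMap.ker b) :
    C ≤ LinearMap.ker (b - b v • a) := by
  intro w hw
  have : w - a w • v ∈ C ⊓ LinearMap.ker a :=
    ⟨C.sub_mem hw (C.smul_mem _ hv), by simp [hav]⟩
  have := hb this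
  simp only [LinearMap.mem_ker, map_sub, map_smul, smul_eq_mul, LinearMap.sub_apply,
    LinearMap.smul_apply] at this ⊢
  rw [mul_comm, this]

lemma dBos_eq_of_decomp (a b : Module.Dual ℂ (Fin n → ℂ)) (c : ℂ) (f : Superspace n) :
    dBos b f = dBos (b - c • a) f + c • dBos a f := by
  rw [← dBos_smul, ← dBos_add, sub_add_cancel]

lemma dFer_eq_of_decomp (a b : Module.Dual ℂ (Fin n → ℂ)) (c : ℂ) (f : Superspace n) :
    dFer b f = dFer (b - c • a) f + c • dFer a f := by
  rw [← dFer_smul, ← dFer_add, sub_add_cancel]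

lemma exists_dual_eq_one {v : Fin n → ℂ} (hv : v ≠ 0) :
    ∃ a : Module.Dual ℂ (Fin n → ℂ), a v = 1 := by
  obtain ⟨i, hi⟩ := Function.ne_iff.mp hv
  exact ⟨(v i)⁻¹ • LinearMap.proj i, by simpa using inv_mul_cancel₀ hi⟩

lemma finrank_inf_ker_lt {v : Fin n → ℂ} (hv : v ∈ C) (hav : a v ≠ 0) :
    Module.finrank ℂ ↥(C ⊓ LinearMap.ker a) < Module.finrank ℂ C :=
  Submodule.finrank_lt_finrank_of_lt
    (lt_of_le_of_ne inf_le_left fun h => hav (h.ge hv).2)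

/-- A space of elements of `Ωₙ` that vanish at the origin and that is stable under the derivatives
along the covectors vanishing on `C` lies in the ideal generated by the variables of `C`. -/
theorem le_superPower_nil_of_stable {M : Submodule ℂ (Superspace n)}
    (hM : ∀ f ∈ M, ∀ a : Module.Dual ℂ (Fin n → ℂ), C ≤ LinearMap.ker a →
      dBos a f ∈ M ∧ dFer a f ∈ M)
    (haug : ∀ f ∈ M, aug n f = 0) : M ≤ superPower [] C := by
  induction hd : Module.finrank ℂ C using Nat.strong_induction_on generalizing C M with
  | _ d ih =>
  by_cases hC : C = ⊥
  · subst hC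
    rw [eq_bot_of_stable (fun f hf a => hM f hf a bot_le) haug]
    exact bot_le
  obtain ⟨v, hv, hv0⟩ := C.exists_mem_ne_zero_of_ne_bot hC
  obtain ⟨a, hav⟩ := exists_dual_eq_one hv0
  -- The target ideal is added to `M` so that `f` may be corrected by multiples of `λ_v` and `dλ_v`
  -- without losing stability.
  let S : Submodule ℂ (Superspace n) := M ⊔ superPower [] C
  have hS : ∀ f ∈ S, ∀ b : Module.Dual ℂ (Fin n → ℂ), C ≤ LinearMap.ker b →
      dBos b f ∈ S ∧ dFer b f ∈ S := by
    intro f hf b hb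
    obtain ⟨x, hx, y, hy, rfl⟩ := Submodule.mem_sup.mp hf
    rw [map_add, map_add]
    exact ⟨Submodule.add_mem_sup (hM x hx b hb).1 (dBos_mem_superPower hb hy),
      Submodule.add_mem_sup (hM x hx b hb).2 (dFer_mem_superPower hb hy)⟩
  -- Elements not involving the variable pair dual to `a`. Since `dBos a` and `dFer a` vanish here,
  -- `T` is stable under all covectors vanishing on `C ⊓ ker a`, and the induction hypothesis
  -- applies.
  let T : Submodule ℂ (Superspace n) := S ⊓ (LinearMap.ker (dBos a) ⊓ LinearMap.ker (dFer a))
  have hT : T ≤ superPower [] (C ⊓ LinearMap.ker a) := by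
    refine ih _ ?_ ?_ ?_ rfl
    · rw [← hd]
      exact finrank_inf_ker_lt hv (by simp [hav])
    · rintro f ⟨hfS, hfb, hff⟩ b hb
      rw [SetLike.mem_coe, LinearMap.mem_ker] at hfb hff
      have hb' := le_ker_sub_smul hv hav hb
      rw [dBos_eq_of_decomp a b (b v), dFer_eq_of_decomp a b (b v), hfb, hff, smul_zero, add_zero,
        add_zero]
      refine ⟨⟨(hS f hfS _ hb').1, ?_, ?_⟩, ⟨(hS f hfS _ hb').2, ?_, ?_⟩⟩ <;>
        simp only [SetLike.mem_coe, LinearMap.mem_ker]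
      · rw [dBos_comm, hfb, map_zero]
      · rw [← dBos_dFer, hff, map_zero]
      · rw [dBos_dFer, hfb, map_zero]
      · rw [dFer_dFer, hff, map_zero, neg_zero]
    · rintro f ⟨hfS, -⟩
      obtain ⟨x, hx, y, hy, rfl⟩ := Submodule.mem_sup.mp hfS
      rw [map_add, haug x hx, aug_superPower hy, add_zero]
  intro f hf
  -- Two corrections bring `f` into `T`: subtracting `λ_v F` kills `dBos a`, then subtracting `dλ_v
  -- * dFer a f₁` kills `dFer a`, because `dFer a` squares to zero and `a v = 1`.
  obtain ⟨F, hF⟩ := exists_primitive_bos_pow (a := a) (v := v) (by simp [hav]) 0 (dBos a f)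
  rw [pow_zero, one_mul] at hF
  set f₁ := f - bos v ^ (0 + 1) * F with hf₁
  have h₁ : dBos a f₁ = 0 := by rw [hf₁, map_sub, hF, sub_self]
  have hp : bos v ^ (0 + 1) * F ∈ superPower [] C := bos_pow_mul_mem hv (by simp [rhoList]) _
  have hq : fer v * dFer a f₁ ∈ superPower [] C := by
    have := bos_pow_mul_fer_mul_mem (l := []) hv (k := 0) (by simp [rhoList]) (dFer a f₁)
    rwa [pow_zero, one_mul] at this
  have h₂ : f₁ - fer v * dFer a f₁ ∈ T := by
    refine ⟨Submodule.sub_mem _ (Submodule.sub_mem _ (Submodule.mem_sup_left hf)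
      (Submodule.mem_sup_right hp)) (Submodule.mem_sup_right hq), ?_, ?_⟩ <;>
      simp only [SetLike.mem_coe, LinearMap.mem_ker, map_sub]
    · rw [dBos_fer_mul, dBos_dFer, h₁, map_zero, mul_zero, sub_zero]
    · rw [dFer_fer_mul, dFer_self, mul_zero, sub_zero, hav, one_smul, sub_self]
  have h₃ := superPower_mono inf_le_left (hT h₂)
  have : f = (f₁ - fer v * dFer a f₁) + fer v * dFer a f₁ + bos v ^ (0 + 1) * F := by
    rw [sub_add_cancel, hf₁, sub_add_cancel]
  rw [this]
  exact Submodule.add_mem _ (Submodule.add_mem _ h₃ hq) hp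

/-- The description of `superPower l C` by conditions on derivatives. -/
def superPerp : List (Module.Dual ℂ (Fin n → ℂ)) → Submodule ℂ (Fin n → ℂ) →
    Submodule ℂ (Superspace n)
  | [], C => superPower [] C
  | a :: l, C => superPerp l C ⊓
      ((superPerp l C).comap (dBos a) ⊓ (superPerp l C).comap (dFer a))

lemma superPower_le_superPerp : superPower l C ≤ superPerp l C := by
  induction l with
  | nil => exact le_rfl
  | cons a l ih =>
    exact fun f hf => ⟨ih (superPower_cons_le hf), ih (dBos_mem_of_cons hf),
      ih (dFer_mem_of_cons hf)⟩

/-- For the empty list, the elements satisfying the hypotheses form a space stable under derivatives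
along every covector vanishing on `C ⊓ ker a`, so `le_superPower_nil_of_stable` applies. For longer
lists the hypotheses pass to `dBos b f` and `dFer b f` because all the operators commute up to sign.
It is not required that `dFer a f = 0`: the kernel of `dBos a` still contains multiples of the dual
fermionic variable. -/
lemma mem_superPerp_inf_ker {f : Superspace n} (hf : f ∈ superPerp l C) (hb : dBos a f = 0)
    (hc : dFer a f ∈ superPerp l C) : f ∈ superPerp l (C ⊓ LinearMap.ker a) := by
  by_cases hC : C ≤ LinearMap.ker a
  · rwa [inf_eq_left.mpr hC]
  obtain ⟨w, hw, haw⟩ := SetLike.not_le_iff_exists.mp hC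
  rw [LinearMap.mem_ker] at haw
  obtain ⟨v, hv, hav⟩ : ∃ v ∈ C, a v = 1 :=
    ⟨(a w)⁻¹ • w, C.smul_mem _ hw, by simp [inv_mul_cancel₀ haw]⟩
  induction l generalizing f with
  | nil =>
    let T : Submodule ℂ (Superspace n) := superPower [] C ⊓
      (LinearMap.ker (dBos a) ⊓ (superPower [] C).comap (dFer a))
    suffices hT : T ≤ superPower [] (C ⊓ LinearMap.ker a) from hT ⟨hf, hb, hc⟩
    refine le_superPower_nil_of_stable ?_ fun f hf => aug_superPower hf.1
    rintro f ⟨hf, hb, hc⟩ b hb'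
    rw [SetLike.mem_coe, LinearMap.mem_ker] at hb
    rw [SetLike.mem_coe, Submodule.mem_comap] at hc
    have hk := le_ker_sub_smul hv hav hb'
    rw [dBos_eq_of_decomp a b (b v), dFer_eq_of_decomp a b (b v), hb, smul_zero, add_zero]
    refine ⟨⟨dBos_mem_superPower hk hf, ?_, ?_⟩, T.add_mem ⟨dFer_mem_superPower hk hf, ?_, ?_⟩
      (T.smul_mem _ ⟨hc, ?_, ?_⟩)⟩ <;>
      simp only [SetLike.mem_coe, LinearMap.mem_ker, Submodule.mem_comap]
    · rw [dBos_comm, hb, map_zero]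
    · rw [← dBos_dFer]; exact dBos_mem_superPower hk hc
    · rw [dBos_dFer, hb, map_zero]
    · rw [dFer_dFer]; exact Submodule.neg_mem _ (dFer_mem_superPower hk hc)
    · rw [dBos_dFer, hb, map_zero]
    · rw [dFer_self]; exact Submodule.zero_mem _
  | cons b l ih =>
    obtain ⟨h0, h1, h2⟩ := hf
    obtain ⟨k0, k1, k2⟩ := hc
    rw [SetLike.mem_coe, Submodule.mem_comap] at h1 h2 k1 k2
    refine ⟨ih h0 hb k0, ih h1 (by rw [dBos_comm, hb, map_zero]) (by rwa [← dBos_dFer]),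
      ih h2 (by rw [dBos_dFer, hb, map_zero]) ?_⟩
    rw [dFer_dFer]
    exact Submodule.neg_mem _ k2

/-- Let `f` satisfy the derivative conditions for `a :: l`. A primitive `F` of `dBos a f` exists
inside `superPower (a :: l) C`; the difference `f - F` is killed by `dBos a`, hence belongs to the
contracted ideal over `C ⊓ ker a`, where prepending `a` changes nothing. -/
theorem superPerp_eq : superPerp l C = superPower l C := by
  refine le_antisymm ?_ superPower_le_superPerp
  induction l generalizing C with
  | nil => exact le_rfl
  | cons a l ih =>
    intro f hf
    by_cases hC : C ≤ LinearMap.ker a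
    · exact superPower_le_cons hC (ih hf.1)
    have ha : a ≠ 0 := by rintro rfl; exact hC (by simp)
    obtain ⟨F, hF, hFf⟩ := exists_primitive_cons ha (ih hf.2.1)
    have hF' := superPower_le_superPerp hF
    have h : f - F ∈ superPerp l (C ⊓ LinearMap.ker a) := by
      refine mem_superPerp_inf_ker (Submodule.sub_mem _ hf.1 hF'.1) ?_ ?_
      · rw [map_sub, hFf, sub_self]
      · rw [map_sub]
        exact Submodule.sub_mem _ hf.2.2 hF'.2.2
    rw [← sub_add_cancel f F]
    exact Submodule.add_mem _ (superPower_inf_ker_le_cons (ih h)) hF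

/-- Deletion and contraction agree on the kernel of the derivative. -/
theorem superPower_cons_inf_ker :
    superPower (a :: l) C ⊓ LinearMap.ker (dBos a) =
      superPower l (C ⊓ LinearMap.ker a) ⊓ LinearMap.ker (dBos a) := by
  refine le_antisymm ?_ (inf_le_inf_right _ superPower_inf_ker_le_cons)
  rintro f ⟨hf, hb⟩
  refine ⟨?_, hb⟩
  -- In the inverse-system description, membership for `a :: l` supplies the condition on `dFer a f`
  -- that the contraction needs.
  rw [SetLike.mem_coe, ← superPerp_eq] at hf ⊢
  exact mem_superPerp_inf_ker hf.1 hb hf.2.2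

end

section

/-! ### Graded subspaces and their Hilbert series -/

/-- A subspace of `Ωₙ` is graded if it is stable under the projections onto the bihomogeneous
components. -/
def IsGraded (M : Submodule ℂ (Superspace n)) : Prop :=
  ∀ f ∈ M, ∀ e, bidegreeProj n e f ∈ M

variable {M M' : Submodule ℂ (Superspace n)} {a : Module.Dual ℂ (Fin n → ℂ)}
  {l : List (Module.Dual ℂ (Fin n → ℂ))} {C : Submodule ℂ (Fin n → ℂ)}

lemma isGraded_top : IsGraded (⊤ : Submodule ℂ (Superspace n)) := fun _ _ _ => trivial

lemma IsGraded.inf_ker_dBos (hM : IsGraded M) (a : Module.Dual ℂ (Fin n → ℂ)) :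
    IsGraded (M ⊓ LinearMap.ker (dBos a)) := by
  rintro f ⟨hf, hb⟩ ⟨i, j⟩
  refine ⟨hM f hf _, ?_⟩
  rw [SetLike.mem_coe, LinearMap.mem_ker] at hb ⊢
  rcases i with _ | i
  · exact dBos_eq_zero (j := j) a (bidegreeProj_mem (0, j) f)
  · rw [dBos_bidegreeProj, hb, map_zero]

lemma bos_pow_mul_mem_bidegree {i j : ℕ} (v : Fin n → ℂ) (k : ℕ) {f : Superspace n}
    (hf : f ∈ bidegree n i j) : bos v ^ k * f ∈ bidegree n (i + k) j := by
  induction k with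
  | zero => simpa using hf
  | succ k ih => rw [pow_succ', mul_assoc]; exact bos_mul_mem v ih

lemma isGraded_superPower (l : List (Module.Dual ℂ (Fin n → ℂ))) (C : Submodule ℂ (Fin n → ℂ)) :
    IsGraded (superPower l C) := by
  intro f hf e
  suffices key : superPower l C ≤ (superPower l C).comap (bidegreeProj n e) from key hf
  refine superPower_le (fun v hv g => ?_) (fun v hv g => ?_) <;>
    induction g using bidegree_induction with
    | add f g hf hg => simp only [mul_add]; exact Submodule.add_mem _ hf hg
    | mem i j g hg => ?_
  · rw [Submodule.mem_comap, bidegreeProj_of_mem (bos_pow_mul_mem_bidegree v _ hg)]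
    split_ifs
    · exact bos_pow_mul_mem hv le_rfl _
    · exact Submodule.zero_mem _
  · rw [Submodule.mem_comap, bidegreeProj_of_mem (bos_pow_mul_mem_bidegree v _ (fer_mul_mem v hg))]
    split_ifs
    · exact bos_pow_mul_fer_mul_mem hv le_rfl _
    · exact Submodule.zero_mem _

/-- The power series in two variables with given coefficients. -/
def seriesOf (F : ℕ → ℕ → ℤ) : MvPowerSeries (Fin 2) ℤ := fun e => F (e 0) (e 1)

lemma coeff_seriesOf (F : ℕ → ℕ → ℤ) (e : Fin 2 →₀ ℕ) :
    MvPowerSeries.coeff e (seriesOf F) = F (e 0) (e 1) := rfl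

lemma seriesOf_eq_X_zero_mul_add {F G K : ℕ → ℕ → ℤ} (h0 : ∀ j, F 0 j = K 0 j)
    (h : ∀ i j, F (i + 1) j = G i j + K (i + 1) j) :
    seriesOf F = MvPowerSeries.X 0 * seriesOf G + seriesOf K := by
  ext e
  rw [map_add, MvPowerSeries.X, MvPowerSeries.coeff_monomial_mul, coeff_seriesOf, coeff_seriesOf,
    coeff_seriesOf, one_mul]
  rcases he : e 0 with _ | k
  · rw [if_neg fun h => by simpa [he] using h 0, h0, zero_add]
  · rw [if_pos (Finsupp.single_le_iff.mpr (by omega)), h]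
    simp [he]

lemma seriesOf_eq_X_one_mul_add {F G K : ℕ → ℕ → ℤ} (h0 : ∀ i, F i 0 = K i 0)
    (h : ∀ i j, F i (j + 1) = G i j + K i (j + 1)) :
    seriesOf F = MvPowerSeries.X 1 * seriesOf G + seriesOf K := by
  ext e
  rw [map_add, MvPowerSeries.X, MvPowerSeries.coeff_monomial_mul, coeff_seriesOf, coeff_seriesOf,
    coeff_seriesOf, one_mul]
  rcases he : e 1 with _ | k
  · rw [if_neg fun h => by simpa [he] using h 1, h0, zero_add]
  · rw [if_pos (Finsupp.single_le_iff.mpr (by omega)), h]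
    simp [he]

/-- The Hilbert series of a graded subspace of `Ωₙ`. -/
def hilb (M : Submodule ℂ (Superspace n)) : MvPowerSeries (Fin 2) ℤ :=
  seriesOf fun i j => (Module.finrank ℂ ↥(M ⊓ bidegree n i j) : ℤ)

/-- Rank-nullity for a linear map restricted to a subspace. -/
lemma finrank_map_add_finrank_inf_ker {V W : Type*} [AddCommGroup V] [Module ℂ V]
    [AddCommGroup W] [Module ℂ W] (T : V →ₗ[ℂ] W) (P : Submodule ℂ V) [Module.Finite ℂ P] :
    Module.finrank ℂ ↥(P.map T) + Module.finrank ℂ ↥(P ⊓ LinearMap.ker T) =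
      Module.finrank ℂ P := by
  have h : (LinearMap.ker (T.domRestrict P)).map P.subtype = P ⊓ LinearMap.ker T := by
    rw [LinearMap.ker_domRestrict, Submodule.map_comap_subtype]
  rw [← LinearMap.finrank_range_add_finrank_ker (T.domRestrict P), LinearMap.range_domRestrict,
    ← Submodule.finrank_map_subtype_eq P (LinearMap.ker (T.domRestrict P)), h]

lemma finrank_eq_of_surj {T : Superspace n →ₗ[ℂ] Superspace n} {V V' : Submodule ℂ (Superspace n)}
    [Module.Finite ℂ V] (hT : ∀ f ∈ M ⊓ V, T f ∈ M' ⊓ V')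
    (hs : ∀ h ∈ M' ⊓ V', ∃ f ∈ M ⊓ V, T f = h) :
    Module.finrank ℂ ↥(M ⊓ V) =
      Module.finrank ℂ ↥(M' ⊓ V') + Module.finrank ℂ ↥(M ⊓ LinearMap.ker T ⊓ V) := by
  have : Module.Finite ℂ ↥(M ⊓ V) := Submodule.finiteDimensional_of_le inf_le_right
  suffices h : (M ⊓ V).map T = M' ⊓ V' by
    rw [← finrank_map_add_finrank_inf_ker T (M ⊓ V), inf_right_comm, h]
  refine le_antisymm (Submodule.map_le_iff_le_comap.mpr hT) ?_
  rintro h hh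
  obtain ⟨f, hf, rfl⟩ := hs h hh
  exact Submodule.mem_map_of_mem hf

/-- Rank–nullity in each bidegree for a surjection lowering the bosonic degree by one; in bosonic
degree `0` everything is kernel. Since `M` is graded, a preimage of a homogeneous element can be
projected to a homogeneous one. -/
lemma hilb_eq_dBos (hM : IsGraded M) (hT : ∀ f ∈ M, dBos a f ∈ M')
    (hs : ∀ h ∈ M', ∃ f ∈ M, dBos a f = h) :
    hilb M = MvPowerSeries.X 0 * hilb M' + hilb (M ⊓ LinearMap.ker (dBos a)) := by
  refine seriesOf_eq_X_zero_mul_add (fun j => ?_) (fun i j => ?_)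
  · have : M ⊓ LinearMap.ker (dBos a) ⊓ bidegree n 0 j = M ⊓ bidegree n 0 j := by
      have h : bidegree n 0 j ≤ LinearMap.ker (dBos a) := fun f hf => dBos_eq_zero a hf
      rw [inf_assoc, inf_eq_right.mpr h]
    rw [this]
  · rw [← Nat.cast_add, finrank_eq_of_surj (M' := M') (V' := bidegree n i j) (T := dBos a)]
    · exact fun f hf => ⟨hT f hf.1, dBos_mem a hf.2⟩
    · rintro h ⟨hh, hd⟩
      obtain ⟨f, hf, rfl⟩ := hs h hh
      refine ⟨bidegreeProj n (i + 1, j) f, ⟨hM f hf _, bidegreeProj_mem (i + 1, j) f⟩, ?_⟩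
      rw [dBos_bidegreeProj, bidegreeProj_of_mem hd, if_pos rfl]

lemma hilb_eq_dFer (hM : IsGraded M) (hT : ∀ f ∈ M, dFer a f ∈ M')
    (hs : ∀ h ∈ M', ∃ f ∈ M, dFer a f = h) :
    hilb M = MvPowerSeries.X 1 * hilb M' + hilb (M ⊓ LinearMap.ker (dFer a)) := by
  refine seriesOf_eq_X_one_mul_add (fun j => ?_) (fun i j => ?_)
  · have : M ⊓ LinearMap.ker (dFer a) ⊓ bidegree n j 0 = M ⊓ bidegree n j 0 := by
      have h : bidegree n j 0 ≤ LinearMap.ker (dFer a) := fun f hf => dFer_eq_zero a hf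
      rw [inf_assoc, inf_eq_right.mpr h]
    rw [this]
  · rw [← Nat.cast_add, finrank_eq_of_surj (M' := M') (V' := bidegree n i j) (T := dFer a)]
    · exact fun f hf => ⟨hT f hf.1, dFer_mem a hf.2⟩
    · rintro h ⟨hh, hd⟩
      obtain ⟨f, hf, rfl⟩ := hs h hh
      refine ⟨bidegreeProj n (i, j + 1) f, ⟨hM f hf _, bidegreeProj_mem (i, j + 1) f⟩, ?_⟩
      rw [dFer_bidegreeProj, bidegreeProj_of_mem hd, if_pos rfl]

/-! ### Deletion and contraction for the quotient series. -/

/-- The Hilbert series of the quotient of `Ωₙ` by `superPower l C`. -/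
def quotHilb (l : List (Module.Dual ℂ (Fin n → ℂ))) (C : Submodule ℂ (Fin n → ℂ)) :
    MvPowerSeries (Fin 2) ℤ :=
  hilb (n := n) ⊤ - hilb (superPower l C)

lemma ne_zero_of_not_le_ker (h : ¬ C ≤ LinearMap.ker a) : a ≠ 0 := by
  rintro rfl; exact h (by simp)

lemma hilb_top_eq (ha : a ≠ 0) : hilb (⊤ : Submodule ℂ (Superspace n)) =
    MvPowerSeries.X 0 * hilb (n := n) ⊤ + hilb (⊤ ⊓ LinearMap.ker (dBos a)) :=
  hilb_eq_dBos isGraded_top (fun _ _ => trivial) fun h _ =>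
    (exists_dBos_eq ha h).imp fun _ hF => ⟨trivial, hF⟩

/-- Here `dBos a` maps the ideal onto itself, so the series of its kernel is `1 - q` times the
series of the ideal. This is the source of the factor `1 - q` in the recursion. -/
lemma hilb_superPower_inf_ker (ha : a ≠ 0) : hilb (superPower l (C ⊓ LinearMap.ker a)) =
    MvPowerSeries.X 0 * hilb (superPower l (C ⊓ LinearMap.ker a)) +
      hilb (superPower l (C ⊓ LinearMap.ker a) ⊓ LinearMap.ker (dBos a)) :=
  hilb_eq_dBos (isGraded_superPower _ _) (fun _ => dBos_mem_superPower inf_le_right)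
    fun _ => exists_primitive_inf_ker ha

/-- Deletion and contraction for the Hilbert series. -/
theorem quotHilb_cons (h : ¬ C ≤ LinearMap.ker a) : quotHilb (a :: l) C =
    MvPowerSeries.X 0 * quotHilb l C +
      (1 - MvPowerSeries.X 0) * quotHilb l (C ⊓ LinearMap.ker a) := by
  have ha := ne_zero_of_not_le_ker h
  have h1 : hilb (superPower (a :: l) C) = MvPowerSeries.X 0 * hilb (superPower l C) +
      hilb (superPower (a :: l) C ⊓ LinearMap.ker (dBos a)) :=
    hilb_eq_dBos (isGraded_superPower _ _) (fun _ => dBos_mem_of_cons)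
      fun _ => exists_primitive_cons ha
  rw [superPower_cons_inf_ker] at h1
  have h2 := hilb_superPower_inf_ker (l := l) (C := C) ha
  rw [quotHilb, quotHilb, quotHilb]
  -- The contributions of the whole ring cancel, because `q + (1 - q) = 1`.
  linear_combination h2 - h1

theorem quotHilb_cons_of_le (h : C ≤ LinearMap.ker a) : quotHilb (a :: l) C = quotHilb l C := by
  rw [quotHilb, quotHilb, le_antisymm superPower_cons_le (superPower_le_cons h)]

lemma exists_eq_one_of_not_le_ker (h : ¬ C ≤ LinearMap.ker a) : ∃ v ∈ C, a v = 1 := by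
  obtain ⟨w, hw, haw⟩ := SetLike.not_le_iff_exists.mp h
  rw [LinearMap.mem_ker] at haw
  exact ⟨(a w)⁻¹ • w, C.smul_mem _ hw, by simp [inv_mul_cancel₀ haw]⟩

lemma fer_mul_mem_superPower_nil {v : Fin n → ℂ} (hv : v ∈ C) (f : Superspace n) :
    fer v * f ∈ superPower [] C := by
  have := bos_pow_mul_fer_mul_mem (l := []) hv (k := 0) (by simp [rhoList]) f
  rwa [pow_zero, one_mul] at this

/-- Passing to a hyperplane of `C` adds a bosonic and a fermionic variable. -/
theorem quotHilb_nil_inf_ker (h : ¬ C ≤ LinearMap.ker a) :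
    (1 - MvPowerSeries.X 0) * quotHilb [] (C ⊓ LinearMap.ker a) =
      (1 + MvPowerSeries.X 1) * quotHilb [] C := by
  have ha := ne_zero_of_not_le_ker h
  obtain ⟨v, hv, hav⟩ := exists_eq_one_of_not_le_ker h
  -- `Z` is the superspace without the variable pair dual to `a`; multiplication by `dλ_v` inverts
  -- `dFer a` on it.
  let Z : Submodule ℂ (Superspace n) := LinearMap.ker (dBos a) ⊓ LinearMap.ker (dFer a)
  have hlift : ∀ f ∈ Z, dFer a (fer v * f) = f ∧ dBos a (fer v * f) = 0 := by
    rintro f ⟨hb, hf⟩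
    rw [SetLike.mem_coe, LinearMap.mem_ker] at hb hf
    rw [dFer_fer_mul, dBos_fer_mul, hb, hf, hav, mul_zero, sub_zero, one_smul]
    exact ⟨rfl, rfl⟩
  have hZ : ∀ f, dBos a f = 0 → dFer a f ∈ Z := fun f hf =>
    ⟨by rw [SetLike.mem_coe, LinearMap.mem_ker, dBos_dFer, hf, map_zero],
      by rw [SetLike.mem_coe, LinearMap.mem_ker, dFer_self]⟩
  -- Filtering by `dBos a` and then `dFer a` gives `(1 - q) hilb ⊤ = (1 + t) hilb Z`, `(1 - q) hilb
  -- I = (1 + t) hilb (I ⊓ Z)`, and, since the ideal of `C` contains `λ_v` and `dλ_v`, `hilb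
  -- (superPower [] C) = q hilb ⊤ + t hilb Z + hilb (I ⊓ Z)`. Hence the quotient series of `C` is
  -- `hilb Z - hilb (I ⊓ Z)`.
  set I := superPower [] (C ⊓ LinearMap.ker a) with hI
  have t1 := hilb_top_eq (n := n) ha
  have t2 : hilb (⊤ ⊓ LinearMap.ker (dBos a)) = MvPowerSeries.X 1 * hilb Z +
      hilb (⊤ ⊓ LinearMap.ker (dBos a) ⊓ LinearMap.ker (dFer a)) :=
    hilb_eq_dFer (isGraded_top.inf_ker_dBos a) (fun f hf => hZ f hf.2)
      fun f hf => ⟨fer v * f, ⟨trivial, (hlift f hf).2⟩, (hlift f hf).1⟩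
  have i1 := hilb_superPower_inf_ker (l := []) (C := C) ha
  have i2 : hilb (I ⊓ LinearMap.ker (dBos a)) = MvPowerSeries.X 1 * hilb (I ⊓ Z) +
      hilb (I ⊓ LinearMap.ker (dBos a) ⊓ LinearMap.ker (dFer a)) :=
    hilb_eq_dFer ((isGraded_superPower _ _).inf_ker_dBos a)
      (fun f hf => ⟨dFer_mem_superPower inf_le_right hf.1, hZ f hf.2⟩)
      fun f hf => ⟨fer v * f, ⟨superPower_mul_left hf.1 _, (hlift f hf.2).2⟩, (hlift f hf.2).1⟩
  have c1 : hilb (superPower [] C) = MvPowerSeries.X 0 * hilb (n := n) ⊤ +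
      hilb (superPower [] C ⊓ LinearMap.ker (dBos a)) := by
    refine hilb_eq_dBos (isGraded_superPower _ _) (fun _ _ => trivial) fun h _ => ?_
    obtain ⟨F, hF⟩ := exists_primitive_bos_pow (a := a) (v := v) (by simp [hav]) 0 h
    exact ⟨_, bos_pow_mul_mem hv (k := 0 + 1) (by simp [rhoList]) F, by rw [hF, pow_zero, one_mul]⟩
  have c2 : hilb (superPower [] C ⊓ LinearMap.ker (dBos a)) = MvPowerSeries.X 1 * hilb Z +
      hilb (superPower [] C ⊓ LinearMap.ker (dBos a) ⊓ LinearMap.ker (dFer a)) :=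
    hilb_eq_dFer ((isGraded_superPower _ _).inf_ker_dBos a) (fun f hf => hZ f hf.2)
      fun f hf => ⟨fer v * f, ⟨fer_mul_mem_superPower_nil hv f, (hlift f hf).2⟩, (hlift f hf).1⟩
  have hIC : superPower [] C ⊓ LinearMap.ker (dBos a) ⊓ LinearMap.ker (dFer a) = I ⊓ Z := by
    refine le_antisymm ?_ ?_
    · rintro f ⟨⟨hf, hb⟩, hc⟩
      refine ⟨mem_superPerp_inf_ker (l := []) hf hb ?_, hb, hc⟩
      rw [LinearMap.mem_ker.mp hc]
      exact Submodule.zero_mem _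
    · rintro f ⟨hf, hb, hc⟩
      exact ⟨⟨superPower_mono inf_le_left hf, hb⟩, hc⟩
  rw [inf_assoc] at t2 i2
  rw [hIC] at c2
  rw [top_inf_eq] at t2
  rw [quotHilb, quotHilb]
  rw [top_inf_eq] at t1
  change hilb (LinearMap.ker (dBos a)) = MvPowerSeries.X 1 * hilb Z + hilb (⊤ ⊓ Z) at t2
  change hilb (I ⊓ LinearMap.ker (dBos a)) = MvPowerSeries.X 1 * hilb (I ⊓ Z) + hilb (I ⊓ Z) at i2
  rw [top_inf_eq] at t2
  linear_combination t1 + t2 - i1 - i2 - (1 + MvPowerSeries.X 1) * (t1 + t2 - c1 - c2)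

/-- With all variables as generators the ideal is the augmentation ideal, so only the constants
survive. -/
theorem quotHilb_nil_top : quotHilb [] (⊤ : Submodule ℂ (Fin n → ℂ)) = 1 := by
  have hmem : ∀ f : Superspace n, f ∈ superPower [] ⊤ ↔ aug n f = 0 := by
    refine fun f => ⟨fun h => aug_superPower h, fun h => ?_⟩
    have key : ∀ f : Superspace n, ∃ c : ℂ, f - c • 1 ∈ superPower [] ⊤ := by
      intro f
      induction f using superspace_induction with
      | one => exact ⟨1, by simp⟩
      | smul c f h =>
        obtain ⟨d, hd⟩ := h
        exact ⟨c * d, by rw [mul_smul, ← smul_sub c f (d • 1)]; exact Submodule.smul_mem _ _ hd⟩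
      | add f g hf hg =>
        obtain ⟨c, hc⟩ := hf
        obtain ⟨d, hd⟩ := hg
        exact ⟨c + d, by rw [add_smul, add_sub_add_comm]; exact Submodule.add_mem _ hc hd⟩
      | bos_mul v f h =>
        refine ⟨0, ?_⟩
        rw [zero_smul, sub_zero, ← pow_one (bos v)]
        exact bos_pow_mul_mem Submodule.mem_top (by simp [rhoList]) _
      | fer_mul v f h =>
        refine ⟨0, ?_⟩
        rw [zero_smul, sub_zero]
        exact fer_mul_mem_superPower_nil Submodule.mem_top f
    obtain ⟨c, hc⟩ := key f
    have := aug_superPower hc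
    rw [map_sub, map_smul, h, map_one, zero_sub, smul_eq_mul, mul_one, neg_eq_zero] at this
    rwa [this, zero_smul, sub_zero] at hc
  have hker : superPower [] ⊤ = LinearMap.ker (aug n).toLinearMap :=
    Submodule.ext fun f => by rw [hmem]; rfl
  ext e
  rw [quotHilb, map_sub, hilb, hilb, coeff_seriesOf, coeff_seriesOf, top_inf_eq,
    ← finrank_map_add_finrank_inf_ker (aug n).toLinearMap (bidegree n (e 0) (e 1)), hker,
    inf_comm, Nat.cast_add, add_sub_cancel_right, MvPowerSeries.coeff_one]
  have haug : ∀ i j, (i, j) ≠ (0, 0) → ∀ f ∈ bidegree n i j, aug n f = 0 := by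
    have h1 : ∀ f : Superspace n, ∀ i j, (i, j) ≠ (0, 0) →
        aug n (bidegreeProj n (i, j) f) = 0 := by
      intro f
      induction f using superspace_induction with
      | one =>
        intro i j h
        rw [bidegreeProj_of_mem one_mem_bidegree, if_neg h, map_zero]
      | smul c f h => intro i j hij; rw [map_smul, map_smul, h i j hij, smul_zero]
      | add f g hf hg => intro i j hij; rw [map_add, map_add, hf i j hij, hg i j hij, add_zero]
      | bos_mul v f h =>
        rintro (_ | i) j -
        · rw [(bidegreeProj_bos_mul v 0 j f).2, map_zero]
        · rw [(bidegreeProj_bos_mul v i j f).1, aug_bos_mul]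
      | fer_mul v f h =>
        rintro i (_ | j) -
        · rw [(bidegreeProj_fer_mul v i 0 f).2, map_zero]
        · rw [(bidegreeProj_fer_mul v i j f).1, aug_fer_mul]
    intro i j hij f hf
    have := h1 f i j hij
    rwa [bidegreeProj_of_mem hf, if_pos rfl] at this
  split_ifs with he
  · subst he
    have : (bidegree n 0 0).map (aug n).toLinearMap = ⊤ := by
      rw [eq_top_iff]
      intro c _
      exact ⟨c • 1, Submodule.smul_mem _ _ one_mem_bidegree, by simp⟩
    have h1 : Module.finrank ℂ ↥((bidegree n 0 0).map (aug n).toLinearMap) = 1 := by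
      rw [this, finrank_top, Module.finrank_self]
    exact congrArg Nat.cast h1
  · have : (bidegree n (e 0) (e 1)).map (aug n).toLinearMap = ⊥ := by
      rw [eq_bot_iff]
      rintro _ ⟨f, hf, rfl⟩
      refine haug _ _ (fun h => he ?_) f hf
      rw [Prod.mk.injEq] at h
      ext k
      fin_cases k
      · exact h.1
      · exact h.2
    simp [this]

lemma quotHilb_nonneg (e : Fin 2 →₀ ℕ) : 0 ≤ MvPowerSeries.coeff e (quotHilb l C) := by
  rw [quotHilb, map_sub, hilb, hilb, coeff_seriesOf, coeff_seriesOf, sub_nonneg, top_inf_eq]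
  exact_mod_cast Submodule.finrank_mono inf_le_right

end

section

/-! ### Specializations of the Hilbert series -/

variable {a : Module.Dual ℂ (Fin n → ℂ)} {l : List (Module.Dual ℂ (Fin n → ℂ))}
  {C : Submodule ℂ (Fin n → ℂ)}

lemma finrank_inf_ker_add_one (h : ¬ C ≤ LinearMap.ker a) :
    Module.finrank ℂ ↥(C ⊓ LinearMap.ker a) + 1 = Module.finrank ℂ C := by
  obtain ⟨v, hv, hav⟩ := exists_eq_one_of_not_le_ker h
  have hm : C.map a = ⊤ := by
    rw [eq_top_iff]
    intro c _
    exact ⟨c • v, C.smul_mem _ hv, by simp [hav]⟩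
  rw [← finrank_map_add_finrank_inf_ker a C, hm, finrank_top, Module.finrank_self, add_comm]

/-- Every subspace is obtained from the whole space by intersecting with hyperplanes. -/
lemma subspace_induction {P : Submodule ℂ (Fin n → ℂ) → Prop} (top : P ⊤)
    (inf_ker : ∀ (D : Submodule ℂ (Fin n → ℂ)) (a : Module.Dual ℂ (Fin n → ℂ)),
      ¬ D ≤ LinearMap.ker a → P D → P (D ⊓ LinearMap.ker a))
    (C : Submodule ℂ (Fin n → ℂ)) : P C := by
  induction hd : n - Module.finrank ℂ C using Nat.strong_induction_on generalizing C with
  | _ d ih =>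
  by_cases hC : C = ⊤
  · rwa [hC]
  -- Hahn–Banach style step: with `a` zero on `C` but not at `v`, the space `C` is the section of `C
  -- + ℂ v` by `ker a`.
  obtain ⟨v, hv⟩ : ∃ v, v ∉ C := by
    by_contra! h
    exact hC (eq_top_iff.mpr fun x _ => h x)
  obtain ⟨a, hav, haC⟩ := Submodule.exists_le_ker_of_notMem hv
  have hD : ¬ C ⊔ Submodule.span ℂ {v} ≤ LinearMap.ker a := fun h =>
    hav (h (Submodule.mem_sup_right (Submodule.mem_span_singleton_self v)))
  have hE : (C ⊔ Submodule.span ℂ {v}) ⊓ LinearMap.ker a = C := by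
    refine le_antisymm ?_ (le_inf le_sup_left haC)
    rintro w ⟨hw, haw⟩
    obtain ⟨x, hx, y, hy, rfl⟩ := Submodule.mem_sup.mp hw
    obtain ⟨c, rfl⟩ := Submodule.mem_span_singleton.mp hy
    have hax : a x = 0 := haC hx
    rw [SetLike.mem_coe, LinearMap.mem_ker, map_add, hax, zero_add, map_smul, smul_eq_mul,
      mul_eq_zero, or_iff_left hav] at haw
    rwa [haw, zero_smul, add_zero]
  have hr := finrank_inf_ker_add_one hD
  rw [hE] at hr
  have hle := (C ⊔ Submodule.span ℂ {v}).finrank_le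
  rw [Module.finrank_fin_fun] at hle
  rw [← hE]
  exact inf_ker _ a hD (ih _ (by omega) _ rfl)

lemma hasSubst_sq : MvPowerSeries.HasSubst
    ![(PowerSeries.X : PowerSeries ℤ) ^ 2, PowerSeries.X] :=
  MvPowerSeries.hasSubst_of_constantCoeff_zero fun i => by
    fin_cases i
    · exact (map_pow _ _ _).trans (by simp [PowerSeries.X])
    · exact MvPowerSeries.constantCoeff_X _

lemma hasSubst_zero : MvPowerSeries.HasSubst
    ![(PowerSeries.X : PowerSeries ℤ), 0] :=
  MvPowerSeries.hasSubst_of_constantCoeff_zero fun i => by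
    fin_cases i
    · exact MvPowerSeries.constantCoeff_X _
    · exact map_zero _

/-- The specialization `(q, t) ↦ (q², q)`. -/
def specSq : MvPowerSeries (Fin 2) ℤ →+* PowerSeries ℤ :=
  (MvPowerSeries.substAlgHom (R := ℤ) hasSubst_sq).toRingHom

/-- The specialization `(q, t) ↦ (q, 0)`. -/
def specZero : MvPowerSeries (Fin 2) ℤ →+* PowerSeries ℤ :=
  (MvPowerSeries.substAlgHom (R := ℤ) hasSubst_zero).toRingHom

lemma specSq_apply (f : MvPowerSeries (Fin 2) ℤ) : specSq f =
    MvPowerSeries.subst ![(PowerSeries.X : PowerSeries ℤ) ^ 2, PowerSeries.X] f :=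
  MvPowerSeries.substAlgHom_apply hasSubst_sq f

lemma specZero_apply (f : MvPowerSeries (Fin 2) ℤ) : specZero f =
    MvPowerSeries.subst ![(PowerSeries.X : PowerSeries ℤ), 0] f :=
  MvPowerSeries.substAlgHom_apply hasSubst_zero f

lemma specSq_X_zero : specSq (MvPowerSeries.X 0) = PowerSeries.X ^ 2 :=
  MvPowerSeries.substAlgHom_X hasSubst_sq 0

lemma specSq_X_one : specSq (MvPowerSeries.X 1) = PowerSeries.X :=
  MvPowerSeries.substAlgHom_X hasSubst_sq 1

lemma specZero_X_zero : specZero (MvPowerSeries.X 0) = PowerSeries.X :=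
  MvPowerSeries.substAlgHom_X hasSubst_zero 0

lemma specZero_X_one : specZero (MvPowerSeries.X 1) = 0 :=
  MvPowerSeries.substAlgHom_X hasSubst_zero 1

lemma one_sub_X_ne_zero : (1 - PowerSeries.X : PowerSeries ℤ) ≠ 0 := by
  intro h
  simpa using congrArg (PowerSeries.coeff 0) h

lemma one_add_X_ne_zero : (1 + PowerSeries.X : PowerSeries ℤ) ≠ 0 := by
  intro h
  simpa using congrArg (PowerSeries.coeff 0) h

/-- Both specializations agree on the quotients by the ideals generated by variables. -/
lemma spec_quotHilb_nil {σ : MvPowerSeries (Fin 2) ℤ →+* PowerSeries ℤ}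
    (h : 1 - σ (MvPowerSeries.X 0) = (1 - PowerSeries.X) * (1 + σ (MvPowerSeries.X 1)))
    (h0 : 1 + σ (MvPowerSeries.X 1) ≠ 0) (C : Submodule ℂ (Fin n → ℂ)) :
    (1 - PowerSeries.X) ^ (n - Module.finrank ℂ C) * σ (quotHilb [] C) = 1 := by
  induction C using subspace_induction with
  | top => simp [quotHilb_nil_top]
  | inf_ker D a hD ih =>
    have hr := finrank_inf_ker_add_one hD
    have hle := D.finrank_le
    rw [Module.finrank_fin_fun] at hle
    have hc : n - Module.finrank ℂ ↥(D ⊓ LinearMap.ker a) = n - Module.finrank ℂ D + 1 := by omega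
    -- By `h`, the factor `1 + σ t` occurs on both sides of the specialized recursion and cancels,
    -- leaving one factor `1 - q` per codimension. The identity `h` reads `1 - q² = (1 - q)(1 + q)`
    -- for one specialization and is trivial for the other.
    have hs := congrArg σ (quotHilb_nil_inf_ker hD)
    simp only [map_mul, map_sub, map_add, map_one, h] at hs
    rw [mul_assoc, mul_left_comm] at hs
    rw [hc, pow_succ, mul_assoc, mul_left_cancel₀ h0 hs, ih]

/-! ### Doubling the arrangement, and the polynomial it yields. -/

/-- Every member of the list repeated twice. -/
def doubleList {α : Type*} (l : List α) : List α := l.flatMap fun a => [a, a]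

lemma doubleList_cons {α : Type*} (a : α) (l : List α) :
    doubleList (a :: l) = a :: a :: doubleList l := rfl

/-- The specialization `(q², q)` of the Hilbert series amounts to doubling all covectors and
setting `t = 0`. -/
theorem specSq_quotHilb (l : List (Module.Dual ℂ (Fin n → ℂ))) (C : Submodule ℂ (Fin n → ℂ)) :
    specSq (quotHilb l C) = specZero (quotHilb (doubleList l) C) := by
  induction l generalizing C with
  | nil =>
    have h1 := spec_quotHilb_nil (σ := specSq)
      (by rw [specSq_X_zero, specSq_X_one]; ring)
      (by rw [specSq_X_one]; exact one_add_X_ne_zero) C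
    have h2 := spec_quotHilb_nil (σ := specZero)
      (by rw [specZero_X_zero, specZero_X_one]; ring)
      (by rw [specZero_X_one, add_zero]; exact one_ne_zero) C
    exact mul_left_cancel₀ (pow_ne_zero _ one_sub_X_ne_zero) (h1.trans h2.symm)
  | cons a l ih =>
    rw [doubleList_cons]
    by_cases h : C ≤ LinearMap.ker a
    · rw [quotHilb_cons_of_le h, quotHilb_cons_of_le h, quotHilb_cons_of_le h, ih]
    -- The second copy of `a` vanishes on `C ⊓ ker a`. The two deletions therefore contribute `q²`,
    -- and the contractions contribute `q(1 - q) + (1 - q) = 1 - q²`.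
    · rw [quotHilb_cons h, quotHilb_cons h, quotHilb_cons h, quotHilb_cons_of_le inf_le_right]
      simp only [map_mul, map_add, map_sub, map_one, specSq_X_zero, specZero_X_zero, ih]
      ring

open Classical in
/-- The polynomial defined by deletion and contraction; its value at `1` is the number of
independent sublists. -/
def countPoly : List (Module.Dual ℂ (Fin n → ℂ)) → Submodule ℂ (Fin n → ℂ) → Polynomial ℤ
  | [], _ => 1
  | a :: l, C => if C ≤ LinearMap.ker a then countPoly l C else
      Polynomial.X * countPoly l C + countPoly l (C ⊓ LinearMap.ker a)

/-- Contraction raises the codimension by one, so the normalizing power absorbs the factor `1 - q`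
and turns the recursion into that of `countPoly`. -/
theorem specZero_quotHilb (l : List (Module.Dual ℂ (Fin n → ℂ)))
    (C : Submodule ℂ (Fin n → ℂ)) :
    (1 - PowerSeries.X) ^ (n - Module.finrank ℂ C) * specZero (quotHilb l C) =
      (countPoly l C : PowerSeries ℤ) := by
  induction l generalizing C with
  | nil =>
    rw [countPoly, Polynomial.coe_one]
    exact spec_quotHilb_nil (σ := specZero)
      (by rw [specZero_X_zero, specZero_X_one]; ring)
      (by rw [specZero_X_one, add_zero]; exact one_ne_zero) C
  | cons a l ih =>
    rw [countPoly]
    split_ifs with h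
    · rw [quotHilb_cons_of_le h, ih]
    · have hr := finrank_inf_ker_add_one h
      have hle := C.finrank_le
      rw [Module.finrank_fin_fun] at hle
      have hc : n - Module.finrank ℂ ↥(C ⊓ LinearMap.ker a) = n - Module.finrank ℂ C + 1 := by
        omega
      rw [quotHilb_cons h, Polynomial.coe_add, Polynomial.coe_mul, Polynomial.coe_X, ← ih, ← ih,
        hc]
      simp only [map_mul, map_add, map_sub, map_one, specZero_X_zero]
      ring

theorem specSq_quotHilb_top (l : List (Module.Dual ℂ (Fin n → ℂ))) :
    specSq (quotHilb l ⊤) = (countPoly (doubleList l) ⊤ : PowerSeries ℤ) := by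
  rw [specSq_quotHilb, ← specZero_quotHilb, finrank_top, Module.finrank_fin_fun, Nat.sub_self,
    pow_zero, one_mul]

/-! ### Coefficients of the specialized series. -/

lemma coeff_specSq (N : ℕ) (f : MvPowerSeries (Fin 2) ℤ) :
    (Function.support fun e : Fin 2 →₀ ℕ =>
      if N = 2 * e 0 + e 1 then MvPowerSeries.coeff e f else 0).Finite ∧
    PowerSeries.coeff N (specSq f) = ∑ᶠ e : Fin 2 →₀ ℕ,
      if N = 2 * e 0 + e 1 then MvPowerSeries.coeff e f else 0 := by
  have h : ∀ e : Fin 2 →₀ ℕ, (if N = 2 * e 0 + e 1 then MvPowerSeries.coeff e f else 0) =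
      MvPowerSeries.coeff e f • MvPowerSeries.coeff (Finsupp.single () N)
        (e.prod fun s k => ![(PowerSeries.X : PowerSeries ℤ) ^ 2, PowerSeries.X] s ^ k) := by
    intro e
    have : (e.prod fun s k => ![(PowerSeries.X : PowerSeries ℤ) ^ 2, PowerSeries.X] s ^ k) =
        PowerSeries.X ^ (2 * e 0 + e 1) := by
      rw [Finsupp.prod_fintype _ _ (fun _ => pow_zero _), Fin.prod_univ_two, pow_add, pow_mul]
      rfl
    rw [this]
    change _ = _ • PowerSeries.coeff N (PowerSeries.X ^ (2 * e 0 + e 1))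
    rw [PowerSeries.coeff_X_pow]
    split_ifs <;> simp
  simp only [h]
  rw [specSq_apply]
  exact ⟨MvPowerSeries.coeff_subst_finite hasSubst_sq f _,
    MvPowerSeries.coeff_subst hasSubst_sq f _⟩

/-- The specialization collects the coefficients with `2 i + j` fixed; being nonnegative, they
cannot cancel. -/
lemma coeff_le_coeff_specSq {f : MvPowerSeries (Fin 2) ℤ}
    (hf : ∀ e, 0 ≤ MvPowerSeries.coeff e f) (e : Fin 2 →₀ ℕ) :
    MvPowerSeries.coeff e f ≤ PowerSeries.coeff (2 * e 0 + e 1) (specSq f) := by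
  obtain ⟨h1, h2⟩ := coeff_specSq (2 * e 0 + e 1) f
  rw [h2]
  have := single_le_finsum e h1 (fun e' => by
    split_ifs
    · exact hf e'
    · exact le_rfl)
  simpa using this

lemma coeff_specZero (i : ℕ) (f : MvPowerSeries (Fin 2) ℤ) :
    PowerSeries.coeff i (specZero f) = MvPowerSeries.coeff (Finsupp.single 0 i) f := by
  rw [specZero_apply]
  refine (MvPowerSeries.coeff_subst hasSubst_zero f (Finsupp.single () i)).trans ?_
  rw [finsum_eq_single _ (Finsupp.single 0 i)]
  · rw [Finsupp.prod_single_index (h := fun s k => ![(PowerSeries.X : PowerSeries ℤ), 0] s ^ k)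
      (pow_zero _)]
    change _ • PowerSeries.coeff i (PowerSeries.X ^ i) = _
    simp
  · intro e he
    rw [Finsupp.prod_fintype _ _ (fun _ => pow_zero _), Fin.prod_univ_two]
    change _ • PowerSeries.coeff i (PowerSeries.X ^ e 0 * 0 ^ e 1) = _
    rcases Nat.eq_zero_or_pos (e 1) with h | h
    · rw [h, pow_zero, mul_one, PowerSeries.coeff_X_pow, if_neg, smul_zero]
      rintro rfl
      refine he (Finsupp.ext fun k => ?_)
      fin_cases k
      · simp
      · simpa using h
    · rw [zero_pow h.ne', mul_zero, map_zero, smul_zero]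

/-- The exponent of `q ^ i t ^ j`. -/
def expOf (p : ℕ × ℕ) : Fin 2 →₀ ℕ := Finsupp.single 0 p.1 + Finsupp.single 1 p.2

lemma expOf_zero (p : ℕ × ℕ) : expOf p 0 = p.1 := by simp [expOf]
lemma expOf_one (p : ℕ × ℕ) : expOf p 1 = p.2 := by simp [expOf]

lemma eq_expOf_iff (e : Fin 2 →₀ ℕ) (p : ℕ × ℕ) : e = expOf p ↔ (e 0, e 1) = p := by
  constructor
  · rintro rfl; rw [expOf_zero, expOf_one]
  · rintro rfl
    ext k
    fin_cases k
    · exact (expOf_zero (e 0, e 1)).symm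
    · exact (expOf_one (e 0, e 1)).symm

/-- If the specialization at `(q², q)` of a series with nonnegative coefficients is a polynomial,
the series is a polynomial with the same sum of coefficients. -/
theorem sum_coeff_of_specSq {f : MvPowerSeries (Fin 2) ℤ}
    (hf : ∀ e, 0 ≤ MvPowerSeries.coeff e f) {P : Polynomial ℤ}
    (hP : specSq f = (P : PowerSeries ℤ)) :
    ∃ S : Finset (ℕ × ℕ), (∀ p ∉ S, MvPowerSeries.coeff (expOf p) f = 0) ∧
      ∑ p ∈ S, MvPowerSeries.coeff (expOf p) f = P.eval 1 := by
  -- Outside this box `2 i + j` exceeds the degree of `P`, so the coefficient at `(i, j)` is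
  -- squeezed between `0` and `0`.
  set S := Finset.range (P.natDegree + 1) ×ˢ Finset.range (P.natDegree + 1) with hS
  have hz : ∀ p ∉ S, MvPowerSeries.coeff (expOf p) f = 0 := by
    intro p hp
    refine le_antisymm ?_ (hf _)
    refine (coeff_le_coeff_specSq hf _).trans_eq ?_
    rw [hP, Polynomial.coeff_coe, Polynomial.coeff_eq_zero_of_natDegree_lt]
    rw [expOf_zero, expOf_one]
    by_contra! h
    refine hp (Finset.mem_product.mpr ⟨Finset.mem_range.mpr ?_, Finset.mem_range.mpr ?_⟩) <;> omega
  refine ⟨S, hz, ?_⟩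
  have hsum : f = ∑ p ∈ S, MvPowerSeries.monomial (expOf p) (MvPowerSeries.coeff (expOf p) f) := by
    ext e
    simp only [map_sum, MvPowerSeries.coeff_monomial, eq_expOf_iff]
    rw [Finset.sum_ite_eq]
    have he : expOf (e 0, e 1) = e := ((eq_expOf_iff e _).mpr rfl).symm
    split_ifs with h
    · rw [he]
    · rw [← hz _ h, he]
  have hPs : P = ∑ p ∈ S, Polynomial.C (MvPowerSeries.coeff (expOf p) f) *
      Polynomial.X ^ (2 * p.1 + p.2) := by
    apply Polynomial.coe_injective ℤ
    rw [← hP]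
    conv_lhs => rw [hsum]
    rw [map_sum, ← Polynomial.coeToPowerSeries.ringHom_apply, map_sum]
    refine Finset.sum_congr rfl fun p _ => ?_
    rw [Polynomial.coeToPowerSeries.ringHom_apply, Polynomial.coe_mul, Polynomial.coe_pow,
      Polynomial.coe_X, Polynomial.coe_C]
    refine (MvPowerSeries.substAlgHom_monomial hasSubst_sq _ _).trans ?_
    rw [Finsupp.prod_fintype _ _ (fun _ => pow_zero _), Fin.prod_univ_two, expOf_zero, expOf_one,
      pow_add, pow_mul]
    rfl
  conv_rhs => rw [hPs]
  simp [Polynomial.eval_finsetSum]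

end

section

/-! ### The Euler operator -/

lemma polyDeriv_proj (k : Fin n) :
    polyDeriv (LinearMap.proj k) = MvPolynomial.pderiv (R := ℂ) k := by
  refine MvPolynomial.derivation_ext fun i => ?_
  rw [← linearForm_single, polyDeriv_linearForm, linearForm_single, MvPolynomial.pderiv_X,
    LinearMap.proj_apply]
  by_cases h : i = k
  · subst h; simp
  · simp [h, Ne.symm h]

lemma euler_apply (f : Superspace n) :
    euler n f = ∑ k, dBos (LinearMap.proj k) f * fer (Pi.single k 1) := by
  rw [euler, LinearMap.sum_apply]
  refine Finset.sum_congr rfl fun k _ => ?_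
  rw [dBos, polyDeriv_proj]
  induction f using TensorProduct.induction_on with
  | zero => simp
  | tmul p w => simp [fer, theta]
  | add f g hf hg => rw [map_add, map_add, add_mul, hf, hg]

lemma euler_bos_pow_mul (v : Fin n → ℂ) (k : ℕ) (f : Superspace n) :
    euler n (bos v ^ (k + 1) * f) =
      ((k + 1 : ℕ) : ℂ) • (bos v ^ k * (f * fer v)) + bos v ^ (k + 1) * euler n f := by
  simp only [euler_apply, dBos_bos_pow_mul, Finset.mul_sum, add_mul, Finset.sum_add_distrib]
  congr 1
  · conv_rhs => rw [fer_eq_sum v, Finset.mul_sum, Finset.mul_sum, Finset.smul_sum]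
    refine Finset.sum_congr rfl fun i _ => ?_
    rw [smul_mul_assoc, mul_smul_comm, mul_smul_comm, smul_smul, mul_assoc, LinearMap.proj_apply]
  · simp only [mul_assoc]

lemma euler_fer_mul (v : Fin n → ℂ) (f : Superspace n) :
    euler n (fer v * f) = fer v * euler n f := by
  simp only [euler_apply, dBos_fer_mul, Finset.mul_sum, mul_assoc]

lemma fer_mul_mul_fer (v : Fin n → ℂ) (f : Superspace n) : fer v * f * fer v = 0 := by
  obtain ⟨f', h⟩ := exists_mul_fer f
  rw [mul_assoc, h, ← mul_assoc, fer_mul_self, zero_mul]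

variable {l : List (Module.Dual ℂ (Fin n → ℂ))} {C : Submodule ℂ (Fin n → ℂ)}

/-- Differentiating the power in `λ ^ (ρ+1) g` produces the fermionic generator `λ ^ ρ dλ`;
differentiating it in `λ ^ ρ dλ g` produces `dλ` twice, which is zero. -/
lemma euler_mem_superPower {f : Superspace n} (hf : f ∈ superPower l C) :
    euler n f ∈ superPower l C := by
  suffices key : superPower l C ≤ (superPower l C).comap (euler n) from key hf
  refine superPower_le (fun v hv g => ?_) (fun v hv g => ?_) <;> rw [Submodule.mem_comap]
  · obtain ⟨g', hg⟩ := exists_mul_fer g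
    rw [euler_bos_pow_mul, hg]
    exact Submodule.add_mem _ (Submodule.smul_mem _ _ (bos_pow_mul_fer_mul_mem hv le_rfl _))
      (bos_pow_mul_mem hv le_rfl _)
  -- For `ρ v = 0` there is no power of `λ_v` to differentiate.
  · rcases hk : rhoList l v with _ | k
    · rw [pow_zero, one_mul, euler_fer_mul, ← one_mul (fer v * _), ← pow_zero (bos v)]
      exact bos_pow_mul_fer_mul_mem hv hk.le _
    · rw [euler_bos_pow_mul, fer_mul_mul_fer, mul_zero, smul_zero, zero_add, euler_fer_mul]
      exact bos_pow_mul_fer_mul_mem hv hk.le _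

/-- `superPower l C` as a left ideal. -/
def superPowerIdeal (l : List (Module.Dual ℂ (Fin n → ℂ))) (C : Submodule ℂ (Fin n → ℂ)) :
    Ideal (Superspace n) where
  carrier := superPower l C
  add_mem' := Submodule.add_mem _
  zero_mem' := Submodule.zero_mem _
  smul_mem' c _ hf := superPower_mul_left hf c

/-! ### Multiarrangements given by lists -/

variable {ι : Type*}

/-- The linear form cutting out the `i`-th hyperplane. -/
def covec (A : Multiarrangement ℂ n ι) (i : ι) : Module.Dual ℂ (Fin n → ℂ) :=
  dotProductBilin ℂ ℂ (A.normal i)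

lemma rho_eq_rhoList (A : Multiarrangement ℂ n ι) {L : List ι} (hL : L.Nodup)
    (hmem : ∀ i, i ∈ L) (v : Fin n → ℂ) : A.rho v = rhoList (L.map (covec A)) v := by
  classical
  have hset : {i | ¬ (Submodule.span ℂ {v} ≤ A.hyperplane i)} =
      ↑(L.toFinset.filter fun i => ¬ covec A i v = 0) := by
    ext i
    simp only [Set.mem_ofPred_eq, Submodule.span_singleton_le_iff_mem, Finset.coe_filter,
      List.mem_toFinset, hmem, true_and]
    rfl
  rw [Multiarrangement.rho, hset, Set.ncard_coe_finset, Finset.card_filter, rhoList, List.map_map,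
    List.sum_toFinset _ hL]
  congr 1
  refine List.map_congr_left fun i _ => ?_
  simp only [Function.comp_apply, ite_not]

lemma linearForm_pow_tmul (v : Fin n → ℂ) (k : ℕ) :
    (linearForm v ^ k) ⊗ₜ[ℂ] (1 : ExteriorAlgebra ℂ (Fin n → ℂ)) = bos v ^ k := by
  rw [bos, Algebra.TensorProduct.tmul_pow, one_pow]

lemma tmul_one_mem_of_mem_powerIdeal (A : Multiarrangement ℂ n ι) {L : List ι} (hL : L.Nodup)
    (hmem : ∀ i, i ∈ L) {p : MvPolynomial (Fin n) ℂ} (hp : p ∈ powerIdeal A 1) :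
    p ⊗ₜ[ℂ] (1 : ExteriorAlgebra ℂ (Fin n → ℂ)) ∈ superPower (L.map (covec A)) ⊤ := by
  induction hp using Submodule.span_induction with
  | mem p hp =>
    obtain ⟨v, -, rfl⟩ := hp
    rw [linearForm_pow_tmul, rho_eq_rhoList A hL hmem, ← mul_one (bos v ^ _)]
    exact bos_pow_mul_mem Submodule.mem_top le_rfl _
  | zero => rw [TensorProduct.zero_tmul]; exact Submodule.zero_mem _
  | add p q _ _ hp hq => rw [TensorProduct.add_tmul]; exact Submodule.add_mem _ hp hq
  | smul c p _ hp =>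
    have := superPower_mul_left hp (c ⊗ₜ 1)
    rwa [Algebra.TensorProduct.tmul_mul_tmul, one_mul] at this

/-- The span is a two-sided ideal closed under `d`. Conversely, any such ideal containing `λ ^
(ρ+1)` contains `d(λ ^ (ρ+1)) = (ρ+1) λ ^ ρ dλ`, and `ρ + 1` is invertible. -/
theorem superIdeal_eq (A : Multiarrangement ℂ n ι) {L : List ι} (hL : L.Nodup)
    (hmem : ∀ i, i ∈ L) : superIdeal A = superPowerIdeal (L.map (covec A)) ⊤ := by
  refine le_antisymm (sInf_le ⟨⟨fun b hf => superPower_mul_right hf b⟩,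
    fun f hf => euler_mem_superPower hf,
    fun p hp => tmul_one_mem_of_mem_powerIdeal A hL hmem hp⟩) (le_sInf ?_)
  rintro I ⟨hI, hd, hJ⟩
  have hb : ∀ v, v ≠ 0 → bos v ^ (rhoList (L.map (covec A)) v + 1) ∈ I := by
    intro v hv
    rw [← linearForm_pow_tmul, ← rho_eq_rhoList A hL hmem]
    exact hJ _ (Ideal.subset_span ⟨v, hv, rfl⟩)
  have key : superPower (L.map (covec A)) ⊤ ≤ I.restrictScalars ℂ := by
    refine superPower_le (fun v _ g => ?_) (fun v _ g => ?_) <;>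
      rw [Submodule.restrictScalars_mem] <;> by_cases hv : v = 0
    -- The power ideal only uses nonzero `v`, while `superPower` also allows `v = 0`; its generators
    -- there are zero, even for the exponent `0`, because `dλ_0 = 0`.
    · rw [hv, bos_zero, pow_succ, mul_zero, zero_mul]
      exact I.zero_mem
    · exact I.mul_mem_right g (hb v hv)
    · rw [hv, fer_zero, zero_mul, mul_zero]
      exact I.zero_mem
    · have h := hd _ (hb v hv)
      rw [← mul_one (bos v ^ _), euler_bos_pow_mul] at h
      have h1 : euler n (1 : Superspace n) = 0 := by simp [euler_apply, dBos_one]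
      rw [h1, mul_zero, add_zero, one_mul] at h
      have h2 := (I.restrictScalars ℂ).smul_mem
        (((rhoList (L.map (covec A)) v + 1 : ℕ) : ℂ))⁻¹ h
      rw [smul_smul, inv_mul_cancel₀ (Nat.cast_ne_zero.mpr (Nat.succ_ne_zero _)), one_smul] at h2
      rw [← mul_assoc]
      exact I.mul_mem_right g h2
  exact key

lemma ker_mkQ_superPowerIdeal (l : List (Module.Dual ℂ (Fin n → ℂ)))
    (C : Submodule ℂ (Fin n → ℂ)) :
    LinearMap.ker ((Submodule.mkQ (superPowerIdeal l C)).restrictScalars ℂ) = superPower l C := by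
  ext f
  rw [LinearMap.mem_ker, LinearMap.restrictScalars_apply, Submodule.mkQ_apply,
    Submodule.Quotient.mk_eq_zero]
  rfl

theorem hilbSuper_eq (l : List (Module.Dual ℂ (Fin n → ℂ))) (C : Submodule ℂ (Fin n → ℂ)) :
    hilbSuper (superPowerIdeal l C) = quotHilb l C := by
  ext e
  rw [quotHilb, map_sub, hilb, hilb, coeff_seriesOf, coeff_seriesOf, top_inf_eq,
    ← finrank_map_add_finrank_inf_ker
      ((Submodule.mkQ (superPowerIdeal l C)).restrictScalars ℂ) (bidegree n (e 0) (e 1)),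
    ker_mkQ_superPowerIdeal, inf_comm, Nat.cast_add, add_sub_cancel_right]
  rfl

/-! ### The bosonic part -/

/-- The inclusion `p ↦ p ⊗ 1`. -/
def inclPoly (n : ℕ) : MvPolynomial (Fin n) ℂ →ₗ[ℂ] Superspace n :=
  (Algebra.TensorProduct.includeLeft (S := ℂ) :
    MvPolynomial (Fin n) ℂ →ₐ[ℂ] Superspace n).toLinearMap

lemma inclPoly_apply (p : MvPolynomial (Fin n) ℂ) : inclPoly n p = p ⊗ₜ 1 := rfl

/-- The retraction of `Ωₙ` onto the polynomial ring that sets all `θᵢ` to zero. -/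
def retrPoly (n : ℕ) : Superspace n →ₐ[ℂ] MvPolynomial (Fin n) ℂ :=
  Algebra.TensorProduct.lift (AlgHom.id ℂ _)
    ((Algebra.ofId ℂ (MvPolynomial (Fin n) ℂ)).comp ExteriorAlgebra.algebraMapInv)
    (fun _ _ => Commute.all _ _)

lemma retrPoly_inclPoly (p : MvPolynomial (Fin n) ℂ) : retrPoly n (inclPoly n p) = p := by
  simp [retrPoly, inclPoly_apply]

lemma retrPoly_bos (v : Fin n → ℂ) : retrPoly n (bos v) = linearForm v := by
  simp [retrPoly, bos]

lemma retrPoly_fer (v : Fin n → ℂ) : retrPoly n (fer v) = 0 := by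
  simp [retrPoly, fer, ExteriorAlgebra.algebraMapInv]

lemma inclPoly_injective : Function.Injective (inclPoly n) :=
  Function.LeftInverse.injective retrPoly_inclPoly

/-- Setting all `θᵢ` to zero kills the fermionic generators and sends the bosonic ones to those of
the power ideal, so no new polynomial enters the super ideal. -/
lemma inclPoly_mem_iff (A : Multiarrangement ℂ n ι) {L : List ι} (hL : L.Nodup)
    (hmem : ∀ i, i ∈ L) (p : MvPolynomial (Fin n) ℂ) :
    inclPoly n p ∈ superPower (L.map (covec A)) ⊤ ↔ p ∈ powerIdeal A 1 := by
  refine ⟨fun h => ?_, fun h => tmul_one_mem_of_mem_powerIdeal A hL hmem h⟩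
  have key : superPower (L.map (covec A)) ⊤ ≤
      ((powerIdeal A 1).restrictScalars ℂ).comap (retrPoly n).toLinearMap := by
    refine superPower_le (fun v _ g => ?_) (fun v _ g => ?_) <;>
      rw [Submodule.mem_comap, Submodule.restrictScalars_mem, AlgHom.toLinearMap_apply]
    · by_cases hv : v = 0
      · rw [hv, bos_zero, pow_succ, mul_zero, zero_mul, map_zero]
        exact Ideal.zero_mem _
      · rw [map_mul, map_pow, retrPoly_bos, ← rho_eq_rhoList A hL hmem]
        exact Ideal.mul_mem_right _ _ (Ideal.subset_span ⟨v, hv, rfl⟩)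
    · rw [map_mul, map_mul, retrPoly_fer, zero_mul, mul_zero]
      exact Ideal.zero_mem _
  have := key h
  rwa [Submodule.mem_comap, Submodule.restrictScalars_mem, AlgHom.toLinearMap_apply,
    retrPoly_inclPoly] at this

lemma bidegree_zero_right (i : ℕ) :
    bidegree n i 0 = (MvPolynomial.homogeneousSubmodule (Fin n) ℂ i).map (inclPoly n) := by
  refine le_antisymm (bidegree_le fun p hp w hw => ?_) ?_
  · obtain ⟨c, rfl⟩ : ∃ c, algebraMap ℂ _ c = w := by
      simpa [Submodule.mem_one] using hw
    refine ⟨c • p, Submodule.smul_mem _ _ hp, ?_⟩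
    rw [inclPoly_apply, TensorProduct.smul_tmul, Algebra.algebraMap_eq_smul_one]
  · rintro _ ⟨p, hp, rfl⟩
    exact tmul_mem_bidegree hp (by simp)

theorem hilbPoly_eq (A : Multiarrangement ℂ n ι) {L : List ι} (hL : L.Nodup)
    (hmem : ∀ i, i ∈ L) :
    hilbPoly (powerIdeal A 1) = specZero (quotHilb (L.map (covec A)) ⊤) := by
  ext i
  rw [coeff_specZero, quotHilb, map_sub, hilb, hilb, coeff_seriesOf, coeff_seriesOf, top_inf_eq,
    hilbPoly, PowerSeries.coeff_mk]
  have h0 : (Finsupp.single (0 : Fin 2) i) 0 = i := by simp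
  have h1 : (Finsupp.single (0 : Fin 2) i) 1 = 0 := by simp
  rw [h0, h1]
  have : Module.Finite ℂ (MvPolynomial.homogeneousSubmodule (Fin n) ℂ i) :=
    Module.Finite.iff_fg.mpr (MvPolynomial.homogeneousSubmodule_fg (σ := Fin n) (R := ℂ) i)
  have hJ : superPower (L.map (covec A)) ⊤ ⊓ bidegree n i 0 =
      (MvPolynomial.homogeneousSubmodule (Fin n) ℂ i ⊓ LinearMap.ker
        ((Submodule.mkQ (powerIdeal A 1)).restrictScalars ℂ)).map (inclPoly n) := by
    rw [bidegree_zero_right]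
    ext f
    constructor
    · rintro ⟨hf, p, hp, rfl⟩
      refine ⟨p, ⟨hp, ?_⟩, rfl⟩
      rw [SetLike.mem_coe, LinearMap.mem_ker, LinearMap.restrictScalars_apply,
        Submodule.mkQ_apply, Submodule.Quotient.mk_eq_zero]
      exact (inclPoly_mem_iff A hL hmem p).mp hf
    · rintro ⟨p, ⟨hp, hpJ⟩, rfl⟩
      rw [SetLike.mem_coe, LinearMap.mem_ker, LinearMap.restrictScalars_apply,
        Submodule.mkQ_apply, Submodule.Quotient.mk_eq_zero] at hpJ
      exact ⟨(inclPoly_mem_iff A hL hmem p).mpr hpJ, p, hp, rfl⟩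
  rw [hJ, bidegree_zero_right,
    ← (Submodule.equivMapOfInjective _ inclPoly_injective _).finrank_eq,
    ← (Submodule.equivMapOfInjective _ inclPoly_injective _).finrank_eq,
    ← finrank_map_add_finrank_inf_ker ((Submodule.mkQ (powerIdeal A 1)).restrictScalars ℂ)
      (MvPolynomial.homogeneousSubmodule (Fin n) ℂ i), Nat.cast_add, add_sub_cancel_right]

/-! ### The dimension of the quotient -/

/-- Only finitely many bidegrees of the quotient are nonzero, and its dimension is the sum of the
coefficients of its series. Since `q = 1` gives `(q², q) = (1, 1)`, this sum is the value of the
specialized polynomial at `1`. -/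
theorem finite_and_finrank_quotient (l : List (Module.Dual ℂ (Fin n → ℂ))) :
    Module.Finite ℂ (Superspace n ⧸ superPowerIdeal l ⊤) ∧
      (Module.finrank ℂ (Superspace n ⧸ superPowerIdeal l ⊤) : ℤ) =
        (countPoly (doubleList l) ⊤).eval 1 := by
  obtain ⟨S, hS, hsum⟩ := sum_coeff_of_specSq
    (fun e => quotHilb_nonneg (l := l) (C := ⊤) e) (specSq_quotHilb_top l)
  set I := superPowerIdeal l (⊤ : Submodule ℂ (Fin n → ℂ)) with hI
  let π : Superspace n →ₗ[ℂ] Superspace n ⧸ I := (Submodule.mkQ I).restrictScalars ℂ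
  have hker : ∀ f, π f = 0 ↔ f ∈ superPower l ⊤ := fun f => by
    rw [← ker_mkQ_superPowerIdeal l ⊤]; rfl
  let N : S → Submodule ℂ (Superspace n ⧸ I) := fun p => (bidegree n p.1.1 p.1.2).map π
  have hN : ∀ p : S, (Module.finrank ℂ (N p) : ℤ) =
      MvPowerSeries.coeff (expOf p) (quotHilb l ⊤) := by
    intro p
    rw [← hilbSuper_eq]
    change _ = (Module.finrank ℂ ((bidegree n (expOf p.1 0) (expOf p.1 1)).map π) : ℤ)
    rw [expOf_zero, expOf_one]
  -- The quotient is identified with the product of its pieces in `S`: the kernel of `Φ` is `I`,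
  -- because `I` is graded and contains every component outside `S`.
  let Φ : Superspace n →ₗ[ℂ] (∀ p : S, N p) := LinearMap.pi fun p =>
    (π ∘ₗ bidegreeProj n p.1).codRestrict (N p)
      fun f => Submodule.mem_map_of_mem (bidegreeProj_mem p.1 f)
  have hΦ : ∀ f p, (Φ f p : Superspace n ⧸ I) = π (bidegreeProj n p.1 f) := fun _ _ => rfl
  have hzero : ∀ p ∉ S, bidegree n p.1 p.2 ≤ superPower l ⊤ := by
    intro p hp
    have h := hS p hp
    rw [← hilbSuper_eq] at h
    change (Module.finrank ℂ ((bidegree n (expOf p 0) (expOf p 1)).map π) : ℤ) = 0 at h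
    rw [expOf_zero, expOf_one, Nat.cast_eq_zero, Submodule.finrank_eq_zero] at h
    intro f hf
    rw [← hker, ← Submodule.mem_bot ℂ, ← h]
    exact Submodule.mem_map_of_mem hf
  have hkerΦ : LinearMap.ker Φ = I.restrictScalars ℂ := by
    ext f
    rw [LinearMap.mem_ker, Submodule.restrictScalars_mem]
    change _ ↔ f ∈ superPower l ⊤
    constructor
    · intro h
      obtain ⟨B, hB⟩ := exists_sum_bidegreeProj f
      rw [← hB B subset_rfl]
      refine Submodule.sum_mem _ fun p _ => ?_
      by_cases hp : p ∈ S
      · rw [← hker, ← hΦ f ⟨p, hp⟩, h]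
        rfl
      · exact hzero p hp (bidegreeProj_mem p f)
    · intro h
      funext p
      rw [Subtype.ext_iff, hΦ]
      exact (hker _).mpr (isGraded_superPower l ⊤ f h p.1)
  have hsurj : Function.Surjective Φ := by
    intro y
    choose x hx hxy using fun p => (y p).2
    refine ⟨∑ p, x p, ?_⟩
    funext p
    rw [Subtype.ext_iff, hΦ, ← hxy p, map_sum]
    congr 1
    rw [Finset.sum_eq_single p]
    · rw [bidegreeProj_of_mem (hx p), if_pos rfl]
    · intro q _ hq
      rw [bidegreeProj_of_mem (hx q), if_neg fun h => hq (Subtype.ext h.symm)]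
    · intro h; exact absurd (Finset.mem_univ p) h
  let E : (Superspace n ⧸ I) ≃ₗ[ℂ] (∀ p : S, N p) :=
    (Submodule.Quotient.restrictScalarsEquiv ℂ I).symm ≪≫ₗ
      Submodule.quotEquivOfEq _ _ hkerΦ.symm ≪≫ₗ Φ.quotKerEquivOfSurjective hsurj
  refine ⟨Module.Finite.equiv E.symm, ?_⟩
  rw [E.finrank_eq, Module.finrank_pi_fintype, Nat.cast_sum, ← hsum, ← Finset.sum_coe_sort S]
  exact Finset.sum_congr rfl fun p _ => hN p

end

section

variable {κ : Type*}

/-! ### Generic deformations -/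

lemma exists_dotProduct_eq {s : Type*} {v : s → Fin n → ℝ} (hv : LinearIndependent ℝ v)
    (c : s → ℝ) : ∃ x, ∀ i, v i ⬝ᵥ x = c i := by
  obtain ⟨φ, hφ⟩ := LinearMap.exists_extend ((Module.Basis.span hv).constr ℝ c)
  refine ⟨fun j => φ (Pi.single j 1), fun i => ?_⟩
  have h : φ (v i) = c i := by
    have h1 := LinearMap.congr_fun hφ (Module.Basis.span hv i)
    rw [Module.Basis.constr_basis, LinearMap.comp_apply, Submodule.subtype_apply,
      Module.Basis.span_apply] at h1
    exact h1
  rw [← h]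
  conv_rhs => rw [pi_eq_sum_univ' (v i), map_sum]
  exact Finset.sum_congr rfl fun j _ => (φ.map_smul _ _).symm

/-- For each dependent subfamily, the translations for which it has a common point form a proper
subspace, and a real vector space is not a finite union of proper subspaces. Independent subfamilies
always meet. -/
theorem exists_isGenericDeformation [Finite κ] (A : Multiarrangement ℝ n κ) :
    ∃ b : κ → ℝ, A.IsGenericDeformation b := by
  classical
  have := Fintype.ofFinite κ
  -- `V S` consists of the `b` agreeing on `S` with the values of the normal forms at some point
  -- `x`.
  let V : Finset κ → Submodule ℝ (κ → ℝ) := fun S =>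
    (LinearMap.range (LinearMap.pi fun i => dotProductBilin ℝ ℝ (A.normal i))) ⊔
      LinearMap.ker (LinearMap.pi fun i : S => LinearMap.proj (R := ℝ) (φ := fun _ : κ => ℝ) i.1)
  let D : Finset (Submodule ℝ (κ → ℝ)) :=
    (Finset.univ.filter fun S : Finset κ => ¬ LinearIndependent ℝ fun i : S => A.normal i).image V
  have hD : ⊤ ∉ D := by
    intro h
    obtain ⟨S, hS, hV⟩ := Finset.mem_image.mp h
    refine (Finset.mem_filter.mp hS).2 (Fintype.linearIndependent_iff.mpr fun c hc i₀ => ?_)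
    -- If `V S` were everything, some `x` would have value `1` at `i₀` and `0` elsewhere on `S`;
    -- pairing the relation `c` with `x` then gives `c i₀ = 0`.
    have hb : (Pi.single i₀.1 1 : κ → ℝ) ∈ V S := hV ▸ Submodule.mem_top
    obtain ⟨_, ⟨x, rfl⟩, z, hz, hxz⟩ := Submodule.mem_sup.mp hb
    have hval : ∀ i : S, A.normal i ⬝ᵥ x = (Pi.single i₀.1 1 : κ → ℝ) i := by
      intro i
      have hzi : z i = 0 := congrFun (LinearMap.mem_ker.mp hz) i
      rw [← hxz, Pi.add_apply, hzi, add_zero]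
      rfl
    have h0 : ∑ i : S, c i * (A.normal i ⬝ᵥ x) = 0 := by
      simp only [← smul_eq_mul, ← smul_dotProduct, ← sum_dotProduct, hc, zero_dotProduct]
    simp only [hval] at h0
    rw [Finset.sum_eq_single i₀] at h0
    · simpa using h0
    · intro i _ hi
      rw [Pi.single_eq_of_ne (fun h => hi (Subtype.ext h)), mul_zero]
    · intro h; exact absurd (Finset.mem_univ _) h
  have hne := Subspace.biUnion_ne_univ_of_top_notMem hD
  obtain ⟨b, hb⟩ := (Set.ne_univ_iff_exists_notMem _).mp hne
  refine ⟨b, fun S => ⟨fun ⟨x, hx⟩ => ?_, fun h => ?_⟩⟩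
  · by_contra hS
    refine hb (Set.mem_iUnion₂.mpr ⟨V S, Finset.mem_image_of_mem _
      (Finset.mem_filter.mpr ⟨Finset.mem_univ _, hS⟩), ?_⟩)
    refine Submodule.mem_sup.mpr ⟨_, ⟨x, rfl⟩, b - fun i => A.normal i ⬝ᵥ x, ?_, ?_⟩
    · rw [LinearMap.mem_ker]
      funext i
      have := Set.mem_iInter₂.mp hx i i.2
      exact sub_eq_zero.mpr (Eq.symm this)
    · exact add_sub_cancel _ _
  · obtain ⟨x, hx⟩ := exists_dotProduct_eq h fun i => b i
    exact ⟨x, Set.mem_iInter₂.mpr fun i hi => hx ⟨i, hi⟩⟩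

/-! ### Sign patterns -/

/-- The value at `x` of the affine form cutting out the `i`-th affine hyperplane. -/
def affineForm (A : Multiarrangement ℝ n κ) (b : κ → ℝ) (i : κ) (x : Fin n → ℝ) : ℝ :=
  A.normal i ⬝ᵥ x - b i

/-- The list of signs of the affine forms with index in `L`. -/
def signs (A : Multiarrangement ℝ n κ) (b : κ → ℝ) (L : List κ) (x : Fin n → ℝ) : List Bool :=
  L.map fun i => decide (0 < affineForm A b i x)

/-- The points of the flat with index list `T` off the hyperplanes with index in `L`. -/
def openFlat (A : Multiarrangement ℝ n κ) (b : κ → ℝ) (L T : List κ) : Set (Fin n → ℝ) :=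
  {x | (∀ i ∈ T, affineForm A b i x = 0) ∧ ∀ i ∈ L, affineForm A b i x ≠ 0}

variable {A : Multiarrangement ℝ n κ} {b : κ → ℝ} {L T : List κ}

lemma affineForm_add_smul (i : κ) (x v : Fin n → ℝ) (t : ℝ) :
    affineForm A b i (x + t • v) = affineForm A b i x + t * (A.normal i ⬝ᵥ v) := by
  rw [affineForm, affineForm, dotProduct_add, dotProduct_smul, smul_eq_mul]; ring

lemma affineForm_combo (i : κ) (x y : Fin n → ℝ) {s t : ℝ} (h : s + t = 1) :
    affineForm A b i (s • x + t • y) = s * affineForm A b i x + t * affineForm A b i y := by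
  simp only [affineForm, dotProduct_add, dotProduct_smul, smul_eq_mul]
  linear_combination b i * h

lemma continuous_affineForm (i : κ) : Continuous (affineForm A b i) := by
  unfold affineForm dotProduct
  fun_prop

lemma signs_eq_iff {x y : Fin n → ℝ} (hx : ∀ i ∈ L, affineForm A b i x ≠ 0)
    (hy : ∀ i ∈ L, affineForm A b i y ≠ 0) :
    signs A b L x = signs A b L y ↔ ∀ i ∈ L, 0 < affineForm A b i x * affineForm A b i y := by
  rw [signs, signs, List.map_inj_left]
  refine forall₂_congr fun i hi => ?_
  rw [decide_eq_decide]
  rcases lt_or_gt_of_ne (hx i hi) with h1 | h1 <;> rcases lt_or_gt_of_ne (hy i hi) with h2 | h2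
  · simp only [h1.not_gt, h2.not_gt, mul_pos_of_neg_of_neg h1 h2]
  · simp only [h1.not_gt, h2, (mul_neg_of_neg_of_pos h1 h2).not_gt, iff_true]
  · simp only [h1, h2.not_gt, (mul_neg_of_pos_of_neg h1 h2).not_gt, iff_false, not_true]
  · simp only [h1, h2, mul_pos h1 h2]

/-- Moving a little in any direction does not change signs. -/
lemma exists_perturb {x : Fin n → ℝ} (hx : ∀ i ∈ L, affineForm A b i x ≠ 0) (v : Fin n → ℝ) :
    ∃ ε > (0 : ℝ), ∀ t, |t| < ε →
      ∀ i ∈ L, 0 < affineForm A b i x * affineForm A b i (x + t • v) := by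
  have h : ∀ᶠ t : ℝ in nhds 0, ∀ i ∈ L,
      0 < affineForm A b i x * affineForm A b i (x + t • v) := by
    refine (Filter.eventually_all_finite (List.finite_toSet L)).mpr fun i hi => ?_
    have hc : Continuous fun t : ℝ => affineForm A b i x * affineForm A b i (x + t • v) :=
      continuous_const.mul ((continuous_affineForm i).comp (by fun_prop))
    refine hc.continuousAt.eventually_const_lt (u := 0) ?_
    simp only [zero_smul, add_zero]
    exact mul_self_pos.mpr (hx i hi)
  obtain ⟨ε, hε, h⟩ := Metric.eventually_nhds_iff.mp h
  exact ⟨ε, hε, fun t ht => h (by rwa [Real.dist_eq, sub_zero])⟩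

lemma signs_finite (s : Set (Fin n → ℝ)) : (signs A b L '' s).Finite := by
  refine (List.finite_length_eq Bool L.length).subset ?_
  rintro _ ⟨x, -, rfl⟩
  simp [signs]

lemma complexify_covec_ofReal (i : κ) (v : Fin n → ℝ) :
    covec A.complexify i (fun j => (v j : ℂ)) = ((A.normal i ⬝ᵥ v : ℝ) : ℂ) := by
  change (∑ j : Fin n, _) = _
  simp [dotProduct, Multiarrangement.complexify]

lemma re_complexify_covec (i : κ) (v : Fin n → ℂ) :
    (covec A.complexify i v).re = A.normal i ⬝ᵥ fun j => (v j).re := by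
  change (∑ j : Fin n, _ : ℂ).re = _
  simp [dotProduct, Multiarrangement.complexify]

lemma im_complexify_covec (i : κ) (v : Fin n → ℂ) :
    (covec A.complexify i v).im = A.normal i ⬝ᵥ fun j => (v j).im := by
  change (∑ j : Fin n, _ : ℂ).im = _
  simp [dotProduct, Multiarrangement.complexify]

/-- A complex flat lies in a real hyperplane if and only if its real points do. -/
lemma le_ker_complexify_iff {C : Submodule ℂ (Fin n → ℂ)}
    (hC : ∀ v, v ∈ C ↔ ∀ j ∈ T, covec A.complexify j v = 0) (i : κ) :
    C ≤ LinearMap.ker (covec A.complexify i) ↔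
      ∀ v : Fin n → ℝ, (∀ j ∈ T, A.normal j ⬝ᵥ v = 0) → A.normal i ⬝ᵥ v = 0 := by
  constructor
  · intro h v hv
    have h1 := h ((hC fun j => (v j : ℂ)).mpr fun j hj => by
      rw [complexify_covec_ofReal, hv j hj, Complex.ofReal_zero])
    rwa [LinearMap.mem_ker, complexify_covec_ofReal, Complex.ofReal_eq_zero] at h1
  · intro h v hv
    have hv' := (hC v).mp hv
    rw [LinearMap.mem_ker]
    apply Complex.ext
    · rw [re_complexify_covec, Complex.zero_re]
      exact h _ fun j hj => by rw [← re_complexify_covec, hv' j hj, Complex.zero_re]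
    · rw [im_complexify_covec, Complex.zero_im]
      exact h _ fun j hj => by rw [← im_complexify_covec, hv' j hj, Complex.zero_im]

/-- In a generic deformation, a hyperplane whose normal vector depends on those of a flat misses
the flat. -/
lemma affineForm_ne_zero_of_dependent (hb : A.IsGenericDeformation b) {i : κ} (hi : i ∉ T)
    (h : ∀ v : Fin n → ℝ, (∀ j ∈ T, A.normal j ⬝ᵥ v = 0) → A.normal i ⬝ᵥ v = 0)
    {x : Fin n → ℝ} (hx : ∀ j ∈ T, affineForm A b j x = 0) : affineForm A b i x ≠ 0 := by
  classical
  intro hix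
  have hne : (⋂ j ∈ insert i T.toFinset, A.affineHyperplane b j).Nonempty := by
    refine ⟨x, Set.mem_iInter₂.mpr fun j hj => sub_eq_zero.mp ?_⟩
    rcases Finset.mem_insert.mp hj with rfl | hj
    · exact hix
    · exact hx j (List.mem_toFinset.mp hj)
  -- A common point makes the normals independent, so `v` can be chosen orthogonal to those of `T`
  -- but not to that of `i`, contradicting `h`.
  obtain ⟨v, hv⟩ := exists_dotProduct_eq ((hb _).mp hne) fun j => if j.1 = i then 1 else 0
  have h1 := hv ⟨i, Finset.mem_insert_self _ _⟩
  rw [if_pos rfl] at h1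
  have h0 := h v fun j hj => by
    have := hv ⟨j, Finset.mem_insert_of_mem (List.mem_toFinset.mpr hj)⟩
    have hji : j ≠ i := fun h => hi (h ▸ hj)
    rwa [if_neg hji] at this
  exact one_ne_zero (h1.symm.trans h0)

lemma signs_cons (i : κ) (x : Fin n → ℝ) :
    signs A b (i :: L) x = decide (0 < affineForm A b i x) :: signs A b L x := rfl

/-- The patterns on `i :: L` when the hyperplane `i` cuts the flat. -/
lemma ncard_signs_cons {i : κ} {v : Fin n → ℝ} (hv : ∀ j ∈ T, A.normal j ⬝ᵥ v = 0)
    (hiv : A.normal i ⬝ᵥ v = 1) :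
    (signs A b (i :: L) '' openFlat A b (i :: L) T).ncard =
      (signs A b L '' openFlat A b L T).ncard +
        (signs A b L '' openFlat A b L (i :: T)).ncard := by
  -- `P` and `N` are the patterns on `L` realized on the two sides of hyperplane `i`. Their union is
  -- all patterns on the flat, their intersection the patterns on its section by `i`, and `|P| + |N|
  -- = |P ∪ N| + |P ∩ N|`.
  let P : Set (List Bool) := signs A b L '' {x ∈ openFlat A b L T | 0 < affineForm A b i x}
  let N : Set (List Bool) := signs A b L '' {x ∈ openFlat A b L T | affineForm A b i x < 0}
  have hmove : ∀ x ∈ openFlat A b L T, ∃ ε > (0 : ℝ), ∀ t, |t| < ε →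
      x + t • v ∈ openFlat A b L T ∧ signs A b L (x + t • v) = signs A b L x ∧
        affineForm A b i (x + t • v) = affineForm A b i x + t := by
    intro x hx
    obtain ⟨ε, hε, h⟩ := exists_perturb hx.2 v
    refine ⟨ε, hε, fun t ht => ?_⟩
    have hne : ∀ j ∈ L, affineForm A b j (x + t • v) ≠ 0 := fun j hj h0 => by
      have := h t ht j hj
      rw [h0, mul_zero] at this
      exact lt_irrefl _ this
    refine ⟨⟨fun j hj => ?_, hne⟩, ((signs_eq_iff hx.2 hne).mpr (h t ht)).symm, ?_⟩
    · rw [affineForm_add_smul, hx.1 j hj, hv j hj, mul_zero, add_zero]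
    · rw [affineForm_add_smul, hiv, mul_one]
  have hcons : signs A b (i :: L) '' openFlat A b (i :: L) T =
      List.cons true '' P ∪ List.cons false '' N := by
    ext p
    constructor
    · rintro ⟨x, hx, rfl⟩
      have hxL : x ∈ openFlat A b L T := ⟨hx.1, fun j hj => hx.2 j (List.mem_cons_of_mem _ hj)⟩
      rw [signs_cons]
      rcases lt_or_gt_of_ne (hx.2 i List.mem_cons_self) with h | h
      · refine Or.inr ⟨_, ⟨x, ⟨hxL, h⟩, rfl⟩, ?_⟩
        rw [decide_eq_false h.le.not_gt]
      · refine Or.inl ⟨_, ⟨x, ⟨hxL, h⟩, rfl⟩, ?_⟩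
        rw [decide_eq_true h]
    · rintro (⟨_, ⟨x, ⟨hx, h⟩, rfl⟩, rfl⟩ | ⟨_, ⟨x, ⟨hx, h⟩, rfl⟩, rfl⟩)
      · refine ⟨x, ⟨hx.1, List.forall_mem_cons.mpr ⟨h.ne', hx.2⟩⟩, ?_⟩
        rw [signs_cons, decide_eq_true h]
      · refine ⟨x, ⟨hx.1, List.forall_mem_cons.mpr ⟨h.ne, hx.2⟩⟩, ?_⟩
        rw [signs_cons, decide_eq_false h.le.not_gt]
  have hunion : P ∪ N = signs A b L '' openFlat A b L T := by
    refine Set.Subset.antisymm (Set.union_subset (Set.image_mono fun x hx => hx.1)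
      (Set.image_mono fun x hx => hx.1)) ?_
    rintro _ ⟨x, hx, rfl⟩
    rcases lt_trichotomy (affineForm A b i x) 0 with h | h | h
    · exact Or.inr ⟨x, ⟨hx, h⟩, rfl⟩
    -- A point on hyperplane `i` is pushed off it along `v` without changing its other signs.
    · obtain ⟨ε, hε, hm⟩ := hmove x hx
      obtain ⟨h1, h2, h3⟩ := hm (ε / 2) (by rw [abs_of_pos (half_pos hε)]; exact half_lt_self hε)
      refine Or.inl ⟨_, ⟨h1, ?_⟩, h2⟩
      rw [h3, h, zero_add]
      exact half_pos hε
    · exact Or.inl ⟨x, ⟨hx, h⟩, rfl⟩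
  have hinter : P ∩ N = signs A b L '' openFlat A b L (i :: T) := by
    refine Set.Subset.antisymm ?_ ?_
    · rintro p ⟨⟨x, ⟨hx, hxi⟩, rfl⟩, ⟨y, ⟨hy, hyi⟩, hxy⟩⟩
      have hsign := (signs_eq_iff hx.2 hy.2).mp hxy.symm
      have hpos : 0 < affineForm A b i x - affineForm A b i y := by linarith
      -- These weights place the convex combination of `x` and `y` on hyperplane `i`; the signs on
      -- `L`, common to both points, persist along the segment.
      set s := -affineForm A b i y / (affineForm A b i x - affineForm A b i y) with hs
      set t := affineForm A b i x / (affineForm A b i x - affineForm A b i y) with ht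
      have hs0 : 0 < s := div_pos (neg_pos.mpr hyi) hpos
      have ht0 : 0 < t := div_pos hxi hpos
      have hst : s + t = 1 := by rw [hs, ht, ← add_div, neg_add_eq_sub, div_self hpos.ne']
      have hsame : ∀ j ∈ L, 0 < affineForm A b j x * affineForm A b j (s • x + t • y) := by
        intro j hj
        rw [affineForm_combo j x y hst, mul_add, mul_left_comm, mul_left_comm _ t]
        exact add_pos (mul_pos hs0 (mul_self_pos.mpr (hx.2 j hj))) (mul_pos ht0 (hsign j hj))
      have hne : ∀ j ∈ L, affineForm A b j (s • x + t • y) ≠ 0 := fun j hj h0 => by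
        have := hsame j hj
        rw [h0, mul_zero] at this
        exact lt_irrefl _ this
      refine ⟨s • x + t • y, ⟨List.forall_mem_cons.mpr ⟨?_, fun j hj => ?_⟩, hne⟩,
        ((signs_eq_iff hx.2 hne).mpr hsame).symm⟩
      · rw [affineForm_combo i x y hst, hs, ht]
        ring
      · rw [affineForm_combo j x y hst, hx.1 j hj, hy.1 j hj, mul_zero, mul_zero, add_zero]
    · rintro _ ⟨x, hx, rfl⟩
      have hx' : x ∈ openFlat A b L T := ⟨fun j hj => hx.1 j (List.mem_cons_of_mem _ hj), hx.2⟩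
      have h0 := hx.1 i List.mem_cons_self
      obtain ⟨ε, hε, hm⟩ := hmove x hx'
      have hlt : |ε / 2| < ε := by rw [abs_of_pos (half_pos hε)]; exact half_lt_self hε
      obtain ⟨h1, h2, h3⟩ := hm (ε / 2) hlt
      obtain ⟨k1, k2, k3⟩ := hm (-(ε / 2)) (by rwa [abs_neg])
      rw [h0, zero_add] at h3 k3
      exact ⟨⟨_, ⟨h1, h3.symm ▸ half_pos hε⟩, h2⟩,
        ⟨_, ⟨k1, k3.symm ▸ neg_neg_of_pos (half_pos hε)⟩, k2⟩⟩
  have hPf : P.Finite := signs_finite _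
  have hNf : N.Finite := signs_finite _
  rw [hcons, Set.ncard_union_eq _ (hPf.image _) (hNf.image _),
    Set.ncard_image_of_injective _ List.cons_injective,
    Set.ncard_image_of_injective _ List.cons_injective, ← hunion, ← hinter,
    Set.ncard_union_add_ncard_inter _ _ hPf hNf]
  rw [Set.disjoint_left]
  rintro _ ⟨p, -, rfl⟩ ⟨q, -, hq⟩
  simp at hq

/-- The number of sign patterns of a generic deformation. -/
theorem ncard_signs (hb : A.IsGenericDeformation b) (hL : L.Nodup) (hLT : ∀ i ∈ L, i ∉ T)
    {C : Submodule ℂ (Fin n → ℂ)} (hC : ∀ v, v ∈ C ↔ ∀ j ∈ T, covec A.complexify j v = 0)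
    (hT : ∃ x, ∀ j ∈ T, affineForm A b j x = 0) :
    ((signs A b L '' openFlat A b L T).ncard : ℤ) =
      (countPoly (L.map (covec A.complexify)) C).eval 1 := by
  induction L generalizing T C with
  | nil =>
    obtain ⟨x, hx⟩ := hT
    have : signs A b [] '' openFlat A b [] T = {[]} :=
      Set.Subset.antisymm (by rintro _ ⟨y, -, rfl⟩; rfl)
        (by rintro _ rfl; exact ⟨x, ⟨hx, by simp⟩, rfl⟩)
    rw [this, Set.ncard_singleton, List.map_nil, countPoly, Polynomial.eval_one, Nat.cast_one]
  | cons i L ih =>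
    rw [List.nodup_cons] at hL
    have hLT' : ∀ j ∈ L, j ∉ T := fun j hj => hLT j (List.mem_cons_of_mem _ hj)
    have hi := hLT i List.mem_cons_self
    rw [List.map_cons, countPoly]
    split_ifs with h
    -- Here the form of `i` is constant on the flat, and nonzero by genericity, so it only adds a
    -- fixed sign to every pattern.
    · have hk := (le_ker_complexify_iff hC i).mp h
      rw [← ih hL.2 hLT' hC hT]
      obtain ⟨x₀, hx₀⟩ := hT
      have hconst : ∀ x, (∀ j ∈ T, affineForm A b j x = 0) →
          affineForm A b i x = affineForm A b i x₀ := by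
        intro x hx
        have := hk (x - x₀) fun j hj => by
          have h1 := hx j hj
          have h2 := hx₀ j hj
          rw [affineForm, sub_eq_zero] at h1 h2
          rw [dotProduct_sub, h1, h2, sub_self]
        rw [dotProduct_sub, sub_eq_zero] at this
        rw [affineForm, affineForm, this]
      have himg : signs A b (i :: L) '' openFlat A b (i :: L) T =
          List.cons (decide (0 < affineForm A b i x₀)) '' (signs A b L '' openFlat A b L T) := by
        rw [Set.image_image]
        have : openFlat A b (i :: L) T = openFlat A b L T := by
          ext x
          refine and_congr_right fun hx => ?_
          rw [List.forall_mem_cons]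
          exact and_iff_right (affineForm_ne_zero_of_dependent hb hi hk hx)
        rw [this]
        refine Set.image_congr fun x hx => ?_
        rw [signs_cons, hconst x hx.1]
      rw [himg, Set.ncard_image_of_injective _ List.cons_injective]
    · have hk := mt (le_ker_complexify_iff hC i).mpr h
      push Not at hk
      obtain ⟨w, hw, hiw⟩ := hk
      have hv : ∀ j ∈ T, A.normal j ⬝ᵥ ((A.normal i ⬝ᵥ w)⁻¹ • w) = 0 := fun j hj => by
        rw [dotProduct_smul, hw j hj, smul_zero]
      have hiv : A.normal i ⬝ᵥ ((A.normal i ⬝ᵥ w)⁻¹ • w) = 1 := by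
        rw [dotProduct_smul, smul_eq_mul, inv_mul_cancel₀ hiw]
      rw [ncard_signs_cons hv hiv, Polynomial.eval_add, Polynomial.eval_mul, Polynomial.eval_X,
        one_mul, Nat.cast_add, ih hL.2 hLT' hC hT, ih hL.2]
      · intro j hj hmem
        rcases List.mem_cons.mp hmem with rfl | hmem
        · exact hL.1 hj
        · exact hLT' j hj hmem
      · intro v
        rw [Submodule.mem_inf, hC, List.forall_mem_cons, and_comm, LinearMap.mem_ker]
      · obtain ⟨x, hx⟩ := hT
        -- Moving along the rescaled `w`, on which form `i` grows at unit speed, reaches hyperplane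
        -- `i` without leaving the flat.
        refine ⟨x + (-affineForm A b i x) • ((A.normal i ⬝ᵥ w)⁻¹ • w),
          List.forall_mem_cons.mpr ⟨?_, fun j hj => ?_⟩⟩
        · rw [affineForm_add_smul, hiv, mul_one, add_neg_cancel]
        · rw [affineForm_add_smul, hv j hj, hx j hj, mul_zero, add_zero]

/-! ### Regions -/

/-- Two maps with the same fibres on `M` have images in bijection. -/
lemma ncard_image_eq_of_iff {α β γ : Type*} {f : α → β} {g : α → γ} {M : Set α}
    (h : ∀ x ∈ M, ∀ y ∈ M, f x = f y ↔ g x = g y) (hf : (f '' M).Finite) :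
    (g '' M).Finite ∧ (g '' M).ncard = (f '' M).ncard := by
  rcases M.eq_empty_or_nonempty with rfl | ⟨x₀, hx₀⟩
  · simp
  have : Nonempty α := ⟨x₀⟩
  let k : β → γ := fun p => g (Function.invFunOn f M p)
  have hk : ∀ x ∈ M, k (f x) = g x := fun x hx =>
    (h _ (Function.invFunOn_mem ⟨x, hx, rfl⟩) x hx).mp (Function.invFunOn_eq ⟨x, hx, rfl⟩)
  have hgk : g '' M = k '' (f '' M) := by
    rw [Set.image_image]
    exact Set.image_congr fun x hx => (hk x hx).symm
  refine ⟨hgk ▸ hf.image k, ?_⟩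
  rw [hgk]
  refine Set.InjOn.ncard_image ?_
  rintro _ ⟨x, hx, rfl⟩ _ ⟨y, hy, rfl⟩ hxy
  rw [hk x hx, hk y hy] at hxy
  exact (h x hx y hy).mpr hxy

lemma openFlat_nil_eq (hmem : ∀ i, i ∈ L) : openFlat A b L [] = A.affineComplement b := by
  ext x
  simp [openFlat, Multiarrangement.affineComplement, Multiarrangement.affineHyperplane, hmem,
    affineForm, sub_eq_zero]

/-- Two points lie in the same region if and only if they have the same signs. -/
lemma signs_eq_iff_connectedComponentIn (hmem : ∀ i, i ∈ L) {x y : Fin n → ℝ}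
    (hx : x ∈ A.affineComplement b) (hy : y ∈ A.affineComplement b) :
    signs A b L x = signs A b L y ↔ connectedComponentIn (A.affineComplement b) x =
      connectedComponentIn (A.affineComplement b) y := by
  have hne : ∀ z ∈ A.affineComplement b, ∀ i, affineForm A b i z ≠ 0 := by
    intro z hz i
    rw [← openFlat_nil_eq hmem] at hz
    exact hz.2 i (hmem i)
  rw [signs_eq_iff (fun i _ => hne x hx i) (fun i _ => hne y hy i)]
  constructor
  · intro h
    -- The cell of points with the signs of `x` is convex, hence connected, and contains both
    -- points.
    let K : Set (Fin n → ℝ) := {z | ∀ i, 0 < affineForm A b i x * affineForm A b i z}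
    have hK : Convex ℝ K := by
      intro z hz w hw s t hs ht hst i
      rw [affineForm_combo i z w hst, mul_add, mul_left_comm, mul_left_comm _ t]
      rcases hs.eq_or_lt with rfl | hs
      · rw [zero_add] at hst
        rw [hst, zero_mul, zero_add, one_mul]
        exact hw i
      · exact add_pos_of_pos_of_nonneg (mul_pos hs (hz i)) (mul_nonneg ht (hw i).le)
    have hKM : K ⊆ A.affineComplement b := by
      intro z hz
      rw [← openFlat_nil_eq hmem]
      refine ⟨by simp, fun i _ h0 => ?_⟩
      have := hz i
      rw [h0, mul_zero] at this
      exact lt_irrefl _ this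
    have hxK : x ∈ K := fun i => mul_self_pos.mpr (hne x hx i)
    exact connectedComponentIn_eq (hK.isPreconnected.subset_connectedComponentIn hxK hKM
      fun i => h i (hmem i))
  · intro h i _
    have hxS : x ∈ connectedComponentIn (A.affineComplement b) x := mem_connectedComponentIn hx
    have hyS : y ∈ connectedComponentIn (A.affineComplement b) x := by
      rw [h]; exact mem_connectedComponentIn hy
    have hpre := isPreconnected_connectedComponentIn (F := A.affineComplement b) (x := x)
    have hcont := (continuous_affineForm (A := A) (b := b) i).continuousOn
      (s := connectedComponentIn (A.affineComplement b) x)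
    -- If the signs at `i` differed, the intermediate value theorem on the component would give a
    -- point of hyperplane `i`.
    by_contra! hle
    have h0 : (0 : ℝ) ∈ affineForm A b i '' connectedComponentIn (A.affineComplement b) x := by
      rcases mul_nonpos_iff.mp hle with ⟨h1, h2⟩ | ⟨h1, h2⟩
      · exact hpre.intermediate_value hyS hxS hcont ⟨h2, h1⟩
      · exact hpre.intermediate_value hxS hyS hcont ⟨h1, h2⟩
    obtain ⟨z, hz, hz0⟩ := h0
    exact hne z (connectedComponentIn_subset _ _ hz) i hz0

theorem finite_regions_and_ncard (hb : A.IsGenericDeformation b) (hL : L.Nodup)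
    (hmem : ∀ i, i ∈ L) : (A.regions b).Finite ∧
      ((A.regions b).ncard : ℤ) = (countPoly (L.map (covec A.complexify)) ⊤).eval 1 := by
  obtain ⟨h1, h2⟩ := ncard_image_eq_of_iff (f := signs A b L)
    (g := connectedComponentIn (A.affineComplement b)) (M := A.affineComplement b)
    (fun x hx y hy => signs_eq_iff_connectedComponentIn hmem hx hy) (signs_finite _)
  refine ⟨h1, ?_⟩
  rw [Multiarrangement.regions, h2, ← openFlat_nil_eq hmem]
  exact ncard_signs hb hL (by simp) (by simp) ⟨0, by simp⟩

/-- The indices of the doubled arrangement. -/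
def doubleIndices {ι : Type*} (L : List ι) : List (ι ⊕ ι) :=
  L.flatMap fun i => [Sum.inl i, Sum.inr i]

lemma nodup_doubleIndices {ι : Type*} {L : List ι} (hL : L.Nodup) : (doubleIndices L).Nodup := by
  rw [doubleIndices, List.nodup_flatMap]
  refine ⟨fun i _ => by simp, hL.imp fun {i j} hij => ?_⟩
  simp [Function.onFun, hij.symm]

lemma mem_doubleIndices {ι : Type*} {L : List ι} (hmem : ∀ i, i ∈ L) (k : ι ⊕ ι) :
    k ∈ doubleIndices L := by
  rcases k with i | i <;> simp [doubleIndices, hmem i]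

/-- Listing the two copies of each index next to each other makes the doubled arrangement match the
doubled list entry by entry. -/
lemma map_covec_doubleIndices {ι : Type*} (A : Multiarrangement ℝ n ι) (L : List ι) :
    (doubleIndices L).map (covec A.double.complexify) =
      doubleList (L.map (covec A.complexify)) := by
  induction L with
  | nil => rfl
  | cons i L ih =>
    rw [List.map_cons, doubleList_cons, ← ih]
    rfl

end

end Superzonotopal

end

/-! ### The main theorem. -/

theorem corollary4p8 {n : ℕ} {ι : Type*} [Finite ι]
    (A : Superzonotopal.Multiarrangement ℝ n ι) :
    MvPowerSeries.subst ![(PowerSeries.X : PowerSeries ℤ) ^ 2, PowerSeries.X]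
        (Superzonotopal.hilbSuper (Superzonotopal.superIdeal A.complexify)) =
      Superzonotopal.hilbPoly (Superzonotopal.powerIdeal A.double.complexify 1) ∧
    Module.Finite ℂ (Superzonotopal.SuperExternal A.complexify) ∧
    (∃ b : ι ⊕ ι → ℝ, A.double.IsGenericDeformation b) ∧
    ∀ b : ι ⊕ ι → ℝ, A.double.IsGenericDeformation b →
      (A.double.regions b).Finite ∧
      Module.finrank ℂ (Superzonotopal.SuperExternal A.complexify) =
        (A.double.regions b).ncard := by
  open Superzonotopal in
  have := Fintype.ofFinite ι
  have hL : (Finset.univ : Finset ι).toList.Nodup := Finset.nodup_toList _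
  have hmem : ∀ i, i ∈ (Finset.univ : Finset ι).toList := fun i =>
    Finset.mem_toList.mpr (Finset.mem_univ i)
  have hdim := finite_and_finrank_quotient
    ((Finset.univ : Finset ι).toList.map (covec A.complexify))
  rw [← superIdeal_eq A.complexify hL hmem] at hdim
  refine ⟨?_, hdim.1, exists_isGenericDeformation _, fun b hb => ?_⟩
  · rw [hilbPoly_eq _ (nodup_doubleIndices hL) (mem_doubleIndices hmem), map_covec_doubleIndices,
      ← specSq_quotHilb, superIdeal_eq A.complexify hL hmem, hilbSuper_eq, specSq_apply]
  · obtain ⟨h1, h2⟩ := finite_regions_and_ncard hb (nodup_doubleIndices hL)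
      (mem_doubleIndices hmem)
    rw [map_covec_doubleIndices, ← hdim.2] at h2
    exact ⟨h1, (Int.natCast_inj.mp h2).symm⟩
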